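/- Let $n,d\ge 2$ be coprime integers, let $\alpha_1,\dots,\alpha_d\in\mathbf{C}$ be distinct, and let $\zeta\in\mathbf{C}$ be a primitive $n$-th root of unity. Let $\mathcal{C}$ be the smooth projective model over $\mathbf{C}$ of the curve $y^n=(x+\alpha_1)\cdots(x+\alpha_d)$, of genus $g=\frac12(n-1)(d-1)$, and let $\mathcal{J}$ be its jacobian, whose points are the degree zero divisor classes on $\mathcal{C}$. Write $\zeta$ also for the automorphism $(x,y)\mapsto(x,\zeta y)$ of $\mathcal{C}$ and for the automorphism of $\mathcal{J}$ that it induces, and let $\mathcal{J}[1-\zeta]$ be the kernel of $1-\zeta$ on $\mathcal{J}$. Then $\mathcal{C}$ has a unique point $\infty$ at infinity (i.e. a unique pole of $x$). For $D\in\mathcal{J}$ let \[ G_\infty(D)=\{k\in\mathbf{Z}_{\ge 0} : h^0(D+k\infty)=h^0(D+(k-1)\infty)\}=\{b_1<b_2<\dots<b_g\} \] be the set of gaps of $D$ at $\infty$ (it has exactly $g$ elements), let $\lambda_D=(b_g-(g-1),\,b_{g-1}-(g-2),\,\dots,\,b_1)$, and let $|\lambda_D|=\sum_{i=1}^{g}(b_i-(i-1))$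 be the size of this partition. Then $\mathcal{J}[1-\zeta]$ is finite and \[ \sum_{D\in\mathcal{J}[1-\zeta]}|\lambda_D|=\frac{g\,(n+1)\,n^{d-1}}{12}. \] -/

import Mathlib

noncomputable section

open Polynomial
open scoped WithZero

namespace FunctionFieldCurve

/-! ### Points and divisors of the smooth projective curve with function field `F` over `K`

The closed points of the smooth projective model of a one-variable function field `F / K` are the
discrete valuation rings of `F` that contain `K`. For `K` algebraically closed every point has
degree one. -/

/-- A point of the smooth projective model, given by its local ring: a discrete valuation ring
with fraction field `F` that contains the constants `K`. -/
@[ext]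
structure Point (K F : Type*) [Field K] [Field F] [Algebra K F] where
  ring : ValuationSubring F
  algebraMap_mem : ∀ c : K, algebraMap K F c ∈ ring
  isDVR : IsDiscreteValuationRing ring

variable {K F : Type*} [Field K] [Field F] [Algebra K F]

instance (P : Point K F) : IsDiscreteValuationRing P.ring := P.isDVR

/-- The normalized multiplicative valuation at `P`. If `f` vanishes to order `m : ℤ` at `P`, then
`P.val f = WithZero.exp (-m)`; also `P.val 0 = 0`. -/
def Point.val (P : Point K F) : Valuation F ℤᵐ⁰ :=
  (IsDiscreteValuationRing.maximalIdeal P.ring).valuation F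

theorem Point.val_uniformizer (P : Point K F) {p : P.ring} (hp : Irreducible p) :
    P.val (p : F) = WithZero.exp (-1) := by
  have h := (IsDiscreteValuationRing.maximalIdeal P.ring).valuation_of_algebraMap (K := F) p
  exact h.trans <| (IsDiscreteValuationRing.maximalIdeal P.ring).intValuation_singleton hp.ne_zero
    hp.maximalIdeal_eq

theorem Point.val_unit (P : Point K F) (u : P.ringˣ) : P.val ((u : P.ring) : F) = 1 := by
  have h := (IsDiscreteValuationRing.maximalIdeal P.ring).valuation_eq_one_iff_notMem (K := F)
    (r := (u : P.ring))
  rw [ValuationSubring.algebraMap_apply] at h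
  rw [Point.val, h]
  exact fun hu => (IsLocalRing.mem_maximalIdeal _).1 hu u.isUnit

theorem Point.val_const_le (P : Point K F) (c : K) : P.val (algebraMap K F c) ≤ 1 :=
  (IsDiscreteValuationRing.maximalIdeal P.ring).valuation_le_one (K := F)
    (⟨_, P.algebraMap_mem c⟩ : P.ring)

/-- The point whose local ring is the preimage of that of `P` under the automorphism `σ` of the
function field. If `σ` is the pullback `h ↦ h ∘ φ` by an automorphism `φ` of the curve, then
this is the point `φ P`. -/
def Point.image (σ : F ≃ₐ[K] F) (P : Point K F) : Point K F where
  ring := P.ring.comap (σ : F →+* F)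
  algebraMap_mem c := by
    rw [ValuationSubring.mem_comap]
    simpa using P.algebraMap_mem c
  isDVR := by
    let e : P.ring ≃+* P.ring.comap (σ : F →+* F) :=
      { toFun := fun a => ⟨σ.symm a, by rw [ValuationSubring.mem_comap]; simp⟩
        invFun := fun b => ⟨σ b, b.2⟩
        left_inv := fun a => by ext; simp
        right_inv := fun b => by ext; simp
        map_mul' := fun a b => by ext; simp
        map_add' := fun a b => by ext; simp }
    exact IsDiscreteValuationRing.RingEquivClass.isDiscreteValuationRing e

theorem Point.val_image (σ : F ≃ₐ[K] F) (P : Point K F) (f : F) :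
    (P.image σ).val f = P.val (σ f) := by
  let e : (P.image σ).ring ≃+* P.ring :=
    { toFun := fun b => ⟨σ b, b.2⟩
      invFun := fun a => ⟨σ.symm a, by
        change _ ∈ P.ring.comap (σ : F →+* F)
        rw [ValuationSubring.mem_comap]; simp⟩
      left_inv := fun a => by ext; simp
      right_inv := fun b => by ext; simp
      map_mul' := fun a b => by ext; simp
      map_add' := fun a b => by ext; simp }
  have he : ∀ b, ((e b : P.ring) : F) = σ b := fun _ => rfl
  have key : ∀ b : (P.image σ).ring, (P.image σ).val (b : F) = P.val (σ b) := by
    intro b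
    rcases eq_or_ne b 0 with rfl | hb
    · simp
    obtain ⟨p, hp⟩ := IsDiscreteValuationRing.exists_irreducible (P.image σ).ring
    obtain ⟨k, u, rfl⟩ := IsDiscreteValuationRing.eq_unit_mul_pow_irreducible hb hp
    have h1 := Point.val_uniformizer (P.image σ) hp
    have h2 := Point.val_uniformizer P ((MulEquiv.irreducible_iff e).2 hp)
    have h3 := Point.val_unit (P.image σ) u
    have h4 := Point.val_unit P (Units.map (e : (P.image σ).ring →* P.ring) u)
    rw [he] at h2
    have h4' : P.val (σ ((u : (P.image σ).ring) : F)) = 1 := h4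
    simp [h1, h2, h3, h4']
  obtain ⟨a, b, hb, rfl⟩ := IsFractionRing.div_surjective (A := (P.image σ).ring) f
  simp only [ValuationSubring.algebraMap_apply, map_div₀, key]

theorem Point.image_image (σ τ : F ≃ₐ[K] F) (P : Point K F) :
    (P.image σ).image τ = P.image (τ.trans σ) := rfl

theorem Point.image_refl (P : Point K F) : P.image AlgEquiv.refl = P := rfl

/-- The permutation of the points induced by an automorphism of the function field. -/
def Point.perm (σ : F ≃ₐ[K] F) : Point K F ≃ Point K F where
  toFun := Point.image σ
  invFun := Point.image σ.symm
  left_inv P := by rw [Point.image_image]; simp [Point.image_refl]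
  right_inv P := by rw [Point.image_image]; simp [Point.image_refl]

/-- Divisors. -/
abbrev Divisor (K F : Type*) [Field K] [Field F] [Algebra K F] := Point K F →₀ ℤ

/-- The degree of a divisor (all points have degree one, `K` being algebraically closed). -/
def deg (K F : Type*) [Field K] [Field F] [Algebra K F] : Divisor K F →+ ℤ :=
  Finsupp.liftAddHom fun _ => AddMonoidHom.id ℤ

/-- The group of principal divisors: those of the form `∑ ord_P(f) P` with `f ≠ 0`. -/
def principal (K F : Type*) [Field K] [Field F] [Algebra K F] : AddSubgroup (Divisor K F) where
  carrier := {D | ∃ f : F, f ≠ 0 ∧ ∀ P : Point K F, P.val f = WithZero.exp (-(D P))}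
  zero_mem' := ⟨1, one_ne_zero, fun P => by simp⟩
  add_mem' := by
    rintro D E ⟨f, hf, hD⟩ ⟨g, hg, hE⟩
    refine ⟨f * g, mul_ne_zero hf hg, fun P => ?_⟩
    rw [map_mul, hD, hE, ← WithZero.exp_add, Finsupp.add_apply, neg_add]
  neg_mem' := by
    rintro D ⟨f, hf, hD⟩
    refine ⟨f⁻¹, inv_ne_zero hf, fun P => ?_⟩
    rw [map_inv₀, hD, ← WithZero.exp_neg, Finsupp.neg_apply]

/-- The Riemann-Roch space `H⁰(D)`: `f = 0` or `ord_P(f) + D(P) ≥ 0` for every point `P`. -/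
def rrSpace (D : Divisor K F) : Submodule K F where
  carrier := {f | ∀ P : Point K F, P.val f ≤ WithZero.exp (D P)}
  zero_mem' P := by simp
  add_mem' {f g} hf hg P := Valuation.map_add_le _ (hf P) (hg P)
  smul_mem' c f hf P := by
    rw [Algebra.smul_def, map_mul]
    exact (mul_le_mul' (P.val_const_le c) (hf P)).trans_eq (one_mul _)

/-- `h⁰(D)`. -/
def h0 (D : Divisor K F) : ℕ := Module.finrank K (rrSpace D)

theorem h0_eq_of_principal {D E : Divisor K F} (h : -D + E ∈ principal K F) : h0 D = h0 E := by
  obtain ⟨f, hf, hDE⟩ := h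
  have hv : ∀ (P : Point K F) (x : F),
      P.val (x / f) ≤ WithZero.exp (E P) ↔ P.val x ≤ WithZero.exp (D P) := by
    intro P x
    rw [map_div₀, hDE, div_le_iff₀ (by simp), ← WithZero.exp_add]
    simp
  let e : rrSpace D ≃ₗ[K] rrSpace E :=
    { toFun := fun x => ⟨(x : F) / f, fun P => (hv P x).2 (x.2 P)⟩
      invFun := fun x => ⟨(x : F) * f, fun P => (hv P _).1 (by
        rw [mul_div_cancel_right₀ _ hf]; exact x.2 P)⟩
      left_inv := fun x => by ext; simp [hf]
      right_inv := fun x => by ext; simp [hf]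
      map_add' := fun x y => by ext; simp [add_div]
      map_smul' := fun c x => by ext; simp [smul_div_assoc] }
  exact e.finrank_eq

/-! ### The jacobian -/

/-- Degree zero divisors. -/
abbrev DivisorZero (K F : Type*) [Field K] [Field F] [Algebra K F] := (deg K F).ker

/-- The group of (`K`-points of) the jacobian: degree zero divisors modulo principal ones. -/
abbrev Jacobian (K F : Type*) [Field K] [Field F] [Algebra K F] :=
  DivisorZero K F ⧸ (principal K F).addSubgroupOf (DivisorZero K F)

/-- Push-forward of divisors along the permutation of points given by `σ`. -/
def divMap (σ : F ≃ₐ[K] F) : Divisor K F →+ Divisor K F :=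
  Finsupp.mapDomain.addMonoidHom (Point.perm σ)

theorem deg_divMap (σ : F ≃ₐ[K] F) (D : Divisor K F) : deg K F (divMap σ D) = deg K F D := by
  have : (deg K F).comp (divMap σ) = deg K F := by
    ext P
    simp [deg, divMap]
  exact DFunLike.congr_fun this D

theorem divMap_mem_principal (σ : F ≃ₐ[K] F) {D : Divisor K F} (hD : D ∈ principal K F) :
    divMap σ D ∈ principal K F := by
  obtain ⟨f, hf, hD⟩ := hD
  refine ⟨σ.symm f, by simpa using hf, fun P => ?_⟩
  obtain ⟨Q, rfl⟩ := (Point.perm σ).surjective P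
  change (Q.image σ).val (σ.symm f) = _
  rw [Point.val_image, AlgEquiv.apply_symm_apply, hD]
  simp [divMap, Finsupp.mapDomain_apply (Point.perm σ).injective]

/-- Push-forward on degree zero divisors. -/
def divZeroMap (σ : F ≃ₐ[K] F) : DivisorZero K F →+ DivisorZero K F :=
  ((divMap σ).comp (deg K F).ker.subtype).codRestrict (deg K F).ker fun D => by
    rw [AddMonoidHom.mem_ker, AddMonoidHom.comp_apply, deg_divMap]
    exact D.2

/-- The endomorphism of the jacobian induced by `σ`. -/
def jacMap (σ : F ≃ₐ[K] F) : Jacobian K F →+ Jacobian K F :=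
  QuotientAddGroup.map _ _ (divZeroMap σ) fun D hD => by
    rw [AddSubgroup.mem_addSubgroupOf] at hD
    rw [AddSubgroup.mem_comap, AddSubgroup.mem_addSubgroupOf]
    exact divMap_mem_principal σ hD

/-! ### Gaps -/

/-- The gaps at `P` of a divisor `D`: all `k ≥ 0` with `h⁰(D + kP) = h⁰(D + (k - 1)P)`. -/
def divGaps (P : Point K F) (D : Divisor K F) : Set ℕ :=
  {k | h0 (D + Finsupp.single P (k : ℤ)) = h0 (D + Finsupp.single P ((k : ℤ) - 1))}

/-- The gap set `G_P(D)` of a degree zero divisor class `D`. -/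
def gaps (P : Point K F) : Jacobian K F → Set ℕ :=
  Quotient.lift (fun D : DivisorZero K F => divGaps P (D : Divisor K F)) fun D E h => by
    have h' : -(D : Divisor K F) + E ∈ principal K F := by
      have := QuotientAddGroup.leftRel_apply.1 h
      rw [AddSubgroup.mem_addSubgroupOf] at this
      exact this
    have hh : ∀ m : ℤ, h0 ((D : Divisor K F) + Finsupp.single P m)
        = h0 ((E : Divisor K F) + Finsupp.single P m) := fun m =>
      h0_eq_of_principal (by convert h' using 1; abel)
    ext k
    simp only [divGaps, Set.mem_ofPred_eq, hh]

/-- The parts `b_g - (g - 1), …, b_2 - 1, b_1` of the partition attached to a set of natural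
numbers whose `g` smallest elements are `b_1 < b_2 < ⋯ < b_g`; here `b_{i+1} = Nat.nth (· ∈ G) i`. -/
def gapPartition (g : ℕ) (G : Set ℕ) : List ℤ :=
  ((List.range g).map fun i => (Nat.nth (· ∈ G) i : ℤ) - i).reverse

end FunctionFieldCurve

open FunctionFieldCurve

/-! ### Superelliptic curves -/

/-- The data of a superelliptic curve `y ^ n = (x + α₁) ⋯ (x + α_d)` over a field `K`, with coprime
`n, d ≥ 2`, distinct `α_i`, and a primitive `n`-th root of unity `ζ ∈ K` (in particular the
characteristic of `K` does not divide `n`). -/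
structure SuperellipticCurve (K : Type*) [Field K] (n d : ℕ) where
  two_le_n : 2 ≤ n
  two_le_d : 2 ≤ d
  coprime : Nat.Coprime n d
  α : Fin d → K
  α_injective : Function.Injective α
  ζ : K
  ζ_primitive : IsPrimitiveRoot ζ n

namespace SuperellipticCurve

variable {K : Type*} [Field K] {n d : ℕ} (C : SuperellipticCurve K n d)

/-- The polynomial `(x + α₁) ⋯ (x + α_d)`. -/
def rhs : K[X] := ∏ i, (X + Polynomial.C (C.α i))

/-- The polynomial `Y ^ n - (x + α₁) ⋯ (x + α_d)` over `K(x)`. -/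
def definingPoly : (RatFunc K)[X] :=
  X ^ n - Polynomial.C (algebraMap K[X] (RatFunc K) C.rhs)

theorem definingPoly_irreducible : Irreducible C.definingPoly := by
  have hn : n ≠ 0 := by have := C.two_le_n; omega
  let i₀ : Fin d := ⟨0, by have := C.two_le_d; omega⟩
  have hprime : Prime (X + Polynomial.C (C.α i₀) : K[X]) := by
    simpa using Polynomial.prime_X_sub_C (-(C.α i₀))
  have hmon : (X ^ n - Polynomial.C C.rhs : K[X][X]).Monic := monic_X_pow_sub_C _ hn
  have hdeg : (X ^ n - Polynomial.C C.rhs : K[X][X]).degree = n :=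
    degree_X_pow_sub_C (Nat.pos_of_ne_zero hn) _
  have hsplit : C.rhs = (X + Polynomial.C (C.α i₀)) *
      ∏ i ∈ Finset.univ.erase i₀, (X + Polynomial.C (C.α i)) :=
    (Finset.mul_prod_erase _ _ (Finset.mem_univ _)).symm
  have hirr : Irreducible (X ^ n - Polynomial.C C.rhs : K[X][X]) := by
    refine irreducible_of_eisenstein_criterion
      (P := Ideal.span {(X + Polynomial.C (C.α i₀) : K[X])})
      ((Ideal.span_singleton_prime hprime.ne_zero).2 hprime) ?_ ?_ ?_ ?_ hmon.isPrimitive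
    · rw [hmon.leadingCoeff, Ideal.mem_span_singleton]
      exact fun h => hprime.not_isUnit (isUnit_of_dvd_one h)
    · intro k hk
      rw [hdeg] at hk
      have hk' : k ≠ n := by
        rintro rfl
        exact lt_irrefl _ hk
      rw [coeff_sub, coeff_X_pow, if_neg hk', zero_sub, Ideal.neg_mem_iff, coeff_C]
      split_ifs
      · rw [Ideal.mem_span_singleton]
        exact Dvd.intro _ hsplit.symm
      · exact zero_mem _
    · rw [hdeg]
      exact_mod_cast Nat.pos_of_ne_zero hn
    · rw [coeff_sub, coeff_X_pow, if_neg hn.symm, zero_sub, Ideal.neg_mem_iff, coeff_C_zero,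
        Ideal.span_singleton_pow, Ideal.mem_span_singleton, hsplit, pow_two]
      intro h
      have h2 := (mul_dvd_mul_iff_left hprime.ne_zero).1 h
      obtain ⟨j, hj, hdvd⟩ := (hprime.dvd_finsetProd_iff _).1 h2
      have h3 : (X + Polynomial.C (C.α j) : K[X]).eval (-(C.α i₀)) = 0 := by
        obtain ⟨q, hq⟩ := hdvd
        rw [hq]
        simp
      have h4 : C.α j = C.α i₀ := by
        simp only [eval_add, eval_X, eval_C] at h3
        linear_combination h3
      exact (Finset.mem_erase.1 hj).1 (C.α_injective h4)
  have h := (hmon.irreducible_iff_irreducible_map_fraction_map (K := RatFunc K)).1 hirr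
  simpa [definingPoly, Polynomial.map_sub, Polynomial.map_pow] using h

instance : Fact (Irreducible C.definingPoly) := ⟨C.definingPoly_irreducible⟩

/-- The function field `K(x)[y] / (y ^ n - (x + α₁) ⋯ (x + α_d))`. -/
abbrev FunctionField : Type _ := AdjoinRoot C.definingPoly

/-- The function `x`. -/
def x : C.FunctionField := algebraMap (RatFunc K) C.FunctionField RatFunc.X

/-- The function `y`. -/
def y : C.FunctionField := AdjoinRoot.root C.definingPoly

/-- The equation of the curve. -/
theorem y_pow : C.y ^ n = algebraMap (RatFunc K) C.FunctionField
    (algebraMap K[X] (RatFunc K) C.rhs) := by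
  have h : aeval (AdjoinRoot.root C.definingPoly)
      (X ^ n - Polynomial.C (algebraMap K[X] (RatFunc K) C.rhs)) = 0 :=
    AdjoinRoot.eval₂_root C.definingPoly
  rw [map_sub, map_pow, aeval_X, aeval_C, sub_eq_zero] at h
  exact h

/-- The pullback of functions under `(x, y) ↦ (x, η y)` for an `n`-th root of unity `η`. -/
def zetaHom (η : K) (hη : η ^ n = 1) : C.FunctionField →ₐ[RatFunc K] C.FunctionField :=
  AdjoinRoot.liftAlgHom C.definingPoly (Algebra.ofId _ _)
    (algebraMap K C.FunctionField η * C.y) (by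
      change aeval _ _ = _
      simp only [definingPoly, map_sub, map_pow, aeval_X, aeval_C, mul_pow]
      rw [← map_pow, hη, map_one, one_mul, C.y_pow, sub_self])

theorem zetaHom_y (η : K) (hη : η ^ n = 1) :
    C.zetaHom η hη C.y = algebraMap K C.FunctionField η * C.y :=
  AdjoinRoot.liftAlgHom_root _ _ _ _

/-- The automorphism `h(x, y) ↦ h(x, ζ y)` of the function field, i.e. the pullback of functions
under the automorphism `ζ : (x, y) ↦ (x, ζ y)` of the curve. -/
def zetaAut : C.FunctionField ≃ₐ[K] C.FunctionField :=
  have hA : C.ζ ^ n = 1 := C.ζ_primitive.pow_eq_one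
  have hB : C.ζ⁻¹ ^ n = 1 := by rw [inv_pow, hA, inv_one]
  (AlgEquiv.ofAlgHom (C.zetaHom C.ζ hA) (C.zetaHom C.ζ⁻¹ hB)
    (by
      have h0 : C.ζ ≠ 0 := C.ζ_primitive.ne_zero (by have := C.two_le_n; omega)
      refine AdjoinRoot.algHom_ext ?_
      change C.zetaHom C.ζ hA (C.zetaHom C.ζ⁻¹ hB C.y) = C.y
      rw [zetaHom_y, map_mul, zetaHom_y,
        IsScalarTower.algebraMap_apply K (RatFunc K) C.FunctionField C.ζ⁻¹, AlgHom.commutes,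
        ← IsScalarTower.algebraMap_apply, ← mul_assoc, ← map_mul, inv_mul_cancel₀ h0, map_one,
        one_mul])
    (by
      have h0 : C.ζ ≠ 0 := C.ζ_primitive.ne_zero (by have := C.two_le_n; omega)
      refine AdjoinRoot.algHom_ext ?_
      change C.zetaHom C.ζ⁻¹ hB (C.zetaHom C.ζ hA C.y) = C.y
      rw [zetaHom_y, map_mul, zetaHom_y,
        IsScalarTower.algebraMap_apply K (RatFunc K) C.FunctionField C.ζ, AlgHom.commutes,
        ← IsScalarTower.algebraMap_apply, ← mul_assoc, ← map_mul, mul_inv_cancel₀ h0, map_one,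
        one_mul])).restrictScalars K

/-- Points of the smooth projective model of the superelliptic curve. -/
abbrev Pt : Type _ := Point K C.FunctionField

/-- The jacobian. -/
abbrev Jac : Type _ := Jacobian K C.FunctionField

/-- A point at infinity: a pole of `x`. -/
def IsAtInfinity (P : C.Pt) : Prop := C.x ∉ P.ring

/-- The kernel `J[1 - ζ]` of the endomorphism `1 - ζ` of the jacobian. -/
def torsion : AddSubgroup C.Jac := (AddMonoidHom.id C.Jac - jacMap C.zetaAut).ker

/-- The genus `(n - 1)(d - 1) / 2` (an integer, as `n` and `d` are coprime). -/
def genus (_ : SuperellipticCurve K n d) : ℕ := (n - 1) * (d - 1) / 2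

/-- The partition `λ_D` of the class `D`, with respect to the point `P` (to be taken at
infinity). -/
def lam (P : C.Pt) (D : C.Jac) : List ℤ := gapPartition C.genus (gaps P D)

/-- The size `|λ_D|`. -/
def lamSize (P : C.Pt) (D : C.Jac) : ℤ := (C.lam P D).sum

end SuperellipticCurve

end

noncomputable section

open Polynomial
open scoped WithZero
open FunctionFieldCurve

namespace FunctionFieldCurve

/-! ### Valuations at points, and extension of places to finite separable extensions -/

section Points

variable {K F : Type*} [Field K] [Field F] [Algebra K F]

/-! The argument is explicit throughout and never uses the Riemann-Roch theorem. The points of the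
curve are all known: one totally ramified point `P_i` over each `x = -α_i`, a fibre of `n` points
permuted simply transitively by the powers of `ζ` over every other finite value of `x`, and one
point at infinity, where `x` and `y` have poles of the coprime orders `n` and `d`.

A class fixed by `ζ` contains a divisor fixed by `ζ`: if `D - ζD = div f`, the norm of `f` has
trivial divisor, so it is constant; after scaling it is `1`, and Hilbert 90 makes `f` a coboundary
(`exists_invariant_divisor`). An invariant divisor of degree zero is, modulo divisors of the
functions `x - a`, of the form `∑ c_i (P_i - ∞)`. Such a divisor is principal exactly when all `c_i`
are congruent modulo `n` (`branchDiv_mem_principal_iff`), so `J[1 - ζ]` is `(ZMod n)^d` modulo the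
diagonal, and a sum over families `a` counts every class `n` times (`sum_residueClass`).

For the class of `a`, averaging over the powers of `ζ` splits the Riemann-Roch space of `D + m∞`
into eigenspaces, the `j`-th one made of polynomials of bounded degree in `x` times a single
eigenfunction (`exists_eq_sum_mul_eigenFun`). Hence the non-gaps are the numbers `n t + s_j` with `t
≥ 0`, where `s_j` is the sum of the representatives of `a_i + j` in `[0, n)`. Since `d` is prime to
`n`, the `s_j` run once through all residues modulo `n`, and the gaps are the smaller natural
numbers in the class of each `s_j`. There are `∑ ⌊s_j / n⌋ = (n - 1)(d - 1) / 2` of them, and `2n`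
times their sum is `∑ s_j²` plus a constant that does not depend on `a` (`two_mul_sum_residueGaps`).

As `a` varies, each `s_j` is distributed like a sum of `d` independent uniform variables on `{0, …,
n - 1}`. Its second moment `d (n² - 1) / 12 + d² (n - 1)² / 4` gives the formula. -/

theorem Point.mem_ring_iff (P : Point K F) (f : F) : f ∈ P.ring ↔ P.val f ≤ 1 := by
  constructor
  · intro h
    exact (IsDiscreteValuationRing.maximalIdeal P.ring).valuation_le_one (K := F) ⟨f, h⟩
  · intro h
    obtain ⟨a, rfl⟩ := IsDiscreteValuationRing.exists_lift_of_le_one h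
    exact a.2

theorem Point.ext_val {P Q : Point K F} (h : ∀ f, P.val f ≤ 1 ↔ Q.val f ≤ 1) : P = Q := by
  ext f
  rw [P.mem_ring_iff, Q.mem_ring_iff, h]

theorem Point.exists_val_eq_exp (P : Point K F) {f : F} (hf : f ≠ 0) :
    ∃ m : ℤ, P.val f = WithZero.exp m :=
  ⟨WithZero.log (P.val f), (WithZero.exp_log ((P.val.ne_zero_iff).2 hf)).symm⟩

theorem Point.exists_uniformizer (P : Point K F) : ∃ f : F, P.val f = WithZero.exp (-1) := by
  obtain ⟨p, hp⟩ := IsDiscreteValuationRing.exists_irreducible P.ring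
  exact ⟨p, P.val_uniformizer hp⟩

theorem Point.val_algebraMap (P : Point K F) {c : K} (hc : c ≠ 0) :
    P.val (algebraMap K F c) = 1 := by
  refine le_antisymm (P.val_const_le c) ?_
  have h := P.val_const_le c⁻¹
  rw [map_inv₀, map_inv₀] at h
  exact (inv_le_one₀ (zero_lt_iff.2 ((P.val.ne_zero_iff).2 (by simpa using hc)))).1 h

/-- The local ring of a point is integrally closed; `φ` moves the coefficients of the integral
equation into it. -/
theorem Point.val_le_one_of_isIntegral (P : Point K F) {A : Type*} [CommRing A] [Algebra A F]
    (hA : ∀ a : A, P.val (algebraMap A F a) ≤ 1) {f : F} (hf : IsIntegral A f) :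
    P.val f ≤ 1 := by
  rw [← P.mem_ring_iff]
  let φ : A →+* P.ring := (algebraMap A F).codRestrict P.ring.toSubring
    fun a => (P.mem_ring_iff _).2 (hA a)
  have h1 : IsIntegral P.ring f := by
    obtain ⟨p, hp, hp0⟩ := hf
    refine ⟨p.map φ, hp.map φ, ?_⟩
    rw [eval₂_map]
    exact hp0
  obtain ⟨a, rfl⟩ := (IsIntegrallyClosed.isIntegral_iff (R := P.ring) (K := F)).1 h1
  exact a.2

/-- The point attached to a nontrivial discrete valuation that is trivial on constants. -/
def Point.ofValuation (v : Valuation F ℤᵐ⁰) (hK : ∀ c : K, v (algebraMap K F c) ≤ 1)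
    (hv : ∃ f, v f ≠ 0 ∧ v f ≠ 1) : Point K F where
  ring := v.valuationSubring
  algebraMap_mem c := hK c
  isDVR := by
    have : Nontrivial (MonoidWithZeroHom.valueGroup (.ofClass v)) := by
      obtain ⟨f, h0, h1⟩ := hv
      rw [Subgroup.nontrivial_iff_exists_ne_one]
      refine ⟨Units.mk0 (v f) h0, ?_, ?_⟩
      · apply MonoidWithZeroHom.mem_valueGroup
        exact ⟨f, rfl⟩
      · intro h
        exact h1 (congrArg Units.val h)
    infer_instance

/-- The valuation `v` need not be normalized, so only comparison with `1` passes between it and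
`Point.val`. -/
theorem Point.ofValuation_val_le_one_iff (v : Valuation F ℤᵐ⁰)
    (hK : ∀ c : K, v (algebraMap K F c) ≤ 1) (hv : ∃ f, v f ≠ 0 ∧ v f ≠ 1) (f : F) :
    (Point.ofValuation v hK hv).val f ≤ 1 ↔ v f ≤ 1 := by
  rw [← Point.mem_ring_iff]
  rfl

/-- A place trivial on `E` would be trivial on everything integral over `E`, including the inverse
of a uniformizer. -/
theorem Point.exists_one_lt_val_algebraMap {E : Type*} [Field E] [Algebra E F]
    [Algebra.IsIntegral E F] (Q : Point K F) : ∃ f : E, 1 < Q.val (algebraMap E F f) := by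
  by_contra! h
  obtain ⟨f, hf⟩ := Q.exists_uniformizer
  have h4 := Q.val_le_one_of_isIntegral h (Algebra.IsIntegral.isIntegral (R := E) f⁻¹)
  rw [map_inv₀, hf, ← WithZero.exp_neg, ← WithZero.exp_zero, WithZero.exp_le_exp] at h4
  norm_num at h4

/-- Every discrete valuation ring of `E` lies below a point of a finite separable extension. -/
theorem Point.exists_over {E : Type*} [Field E] [Algebra K E] [Algebra E F] [IsScalarTower K E F]
    [FiniteDimensional E F] [Algebra.IsSeparable E F] (V : Point K E) :
    ∃ Q : Point K F, ∀ f : E, V.val f ≤ 1 ↔ Q.val (algebraMap E F f) ≤ 1 := by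
  let C := integralClosure V.ring F
  have : IsDedekindDomain C := IsIntegralClosure.isDedekindDomain V.ring E F C
  have : IsFractionRing C F := IsIntegralClosure.isFractionRing_of_finite_extension V.ring E F C
  have hinj : Function.Injective (algebraMap V.ring C) := by
    have : Function.Injective (algebraMap V.ring F) := by
      rw [IsScalarTower.algebraMap_eq V.ring E F]
      exact (algebraMap E F).injective.comp Subtype.val_injective
    rw [IsScalarTower.algebraMap_eq V.ring C F, RingHom.coe_comp] at this
    exact Function.Injective.of_comp this
  have hnf : ¬ IsField C := fun h =>
    IsDiscreteValuationRing.not_isField V.ring (isField_of_isIntegral_of_isField hinj h)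
  -- Any maximal ideal of the integral closure will do: its valuation is at most `1` on `V.ring`.
  obtain ⟨M, hM⟩ := Ideal.exists_maximal C
  let w : IsDedekindDomain.HeightOneSpectrum C :=
    ⟨M, hM.isPrime, Ring.ne_bot_of_isMaximal_of_not_isField hM hnf⟩
  have hw : ∀ f : E, V.val f ≤ 1 → w.valuation F (algebraMap E F f) ≤ 1 := by
    intro f hf
    have h := w.valuation_le_one (K := F) (algebraMap V.ring C ⟨f, (V.mem_ring_iff f).2 hf⟩)
    exact h
  let Q : Point K F := Point.ofValuation (w.valuation F)
    (fun c => by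
      rw [IsScalarTower.algebraMap_apply K E F]
      exact hw _ (V.val_const_le c))
    (by
      obtain ⟨π, hπ⟩ := w.valuation_exists_uniformizer F
      exact ⟨π, by simp [hπ], by
        rw [hπ, ← WithZero.exp_zero, Ne, WithZero.exp_inj]; norm_num⟩)
  have hQ : ∀ f : E, V.val f ≤ 1 → Q.val (algebraMap E F f) ≤ 1 := fun f hf =>
    (Point.ofValuation_val_le_one_iff _ _ _ _).2 (hw f hf)
  refine ⟨Q, fun f => ⟨hQ f, fun hf => ?_⟩⟩
  -- A discrete valuation ring is a maximal proper subring: each `g` is an element of `V.ring` times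
  -- a power of `f`, so if `f` were regular at `Q`, all of `E` would be.
  by_contra! hVf
  obtain ⟨g, hg⟩ := Q.exists_one_lt_val_algebraMap (E := E)
  refine absurd hg (not_lt.2 ?_)
  have hf0 : f ≠ 0 := by rintro rfl; simp at hVf
  have hg0 : g ≠ 0 := by rintro rfl; simp at hg
  obtain ⟨m, hm⟩ := V.exists_val_eq_exp hf0
  obtain ⟨l, hl⟩ := V.exists_val_eq_exp hg0
  rw [hm, ← WithZero.exp_zero, WithZero.exp_lt_exp] at hVf
  have h1 := hQ (g / f ^ l.toNat) (by
    rw [map_div₀, map_pow, hm, hl, ← WithZero.exp_nsmul, ← WithZero.exp_sub, ← WithZero.exp_zero,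
      WithZero.exp_le_exp, nsmul_eq_mul]
    have := Int.self_le_toNat l
    nlinarith)
  have h2 : algebraMap E F g = algebraMap E F (g / f ^ l.toNat) * algebraMap E F f ^ l.toNat := by
    rw [← map_pow, ← map_mul, div_mul_cancel₀ _ (pow_ne_zero _ hf0)]
  rw [h2, map_mul, map_pow]
  exact mul_le_one' h1 (pow_le_one' hf _)

end Points

end FunctionFieldCurve

namespace SuperellipticCurve

variable {K : Type*} [Field K] {n d : ℕ} (C : SuperellipticCurve K n d)

/-! ### Expansions in powers of `y` and the cyclic group generated by `ζ` -/

section Expansion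

theorem n_pos (C : SuperellipticCurve K n d) : 0 < n := by have := C.two_le_n; omega

theorem definingPoly_monic : C.definingPoly.Monic := monic_X_pow_sub_C _ C.n_pos.ne'

theorem natDegree_definingPoly : C.definingPoly.natDegree = n := natDegree_X_pow_sub_C

instance : FiniteDimensional (RatFunc K) C.FunctionField :=
  C.definingPoly_monic.finite_adjoinRoot

theorem exists_expansion (f : C.FunctionField) : ∃ h : ℕ → RatFunc K,
    f = ∑ j ∈ Finset.range n, algebraMap (RatFunc K) C.FunctionField (h j) * C.y ^ j := by
  obtain ⟨p, rfl⟩ := AdjoinRoot.mk_surjective f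
  refine ⟨fun j => (p %ₘ C.definingPoly).coeff j, ?_⟩
  have h1 : AdjoinRoot.mk C.definingPoly p = AdjoinRoot.mk C.definingPoly (p %ₘ C.definingPoly) := by
    rw [AdjoinRoot.mk_eq_mk]
    exact ⟨p /ₘ C.definingPoly, by
      have := modByMonic_add_div p C.definingPoly
      linear_combination -this⟩
  have h2 : (p %ₘ C.definingPoly).natDegree < n := by
    have := natDegree_modByMonic_lt p C.definingPoly_monic (by
      intro h
      have h3 := C.natDegree_definingPoly
      rw [h, natDegree_one] at h3
      have := C.n_pos
      omega)
    rwa [natDegree_definingPoly] at this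
  rw [h1]
  conv_lhs => rw [(p %ₘ C.definingPoly).as_sum_range' n h2]
  rw [map_sum]
  refine Finset.sum_congr rfl fun j _ => ?_
  rw [← C_mul_X_pow_eq_monomial, map_mul, map_pow, AdjoinRoot.mk_X, AdjoinRoot.mk_C]
  rfl

theorem y_ne_zero : C.y ≠ 0 := by
  intro h
  have := C.y_pow
  rw [h, zero_pow C.n_pos.ne', eq_comm, map_eq_zero, map_eq_zero_iff _
    (IsFractionRing.injective K[X] (RatFunc K)), rhs, Finset.prod_eq_zero_iff] at this
  obtain ⟨i, -, hi⟩ := this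
  exact (monic_X_add_C (C.α i)).ne_zero hi

end Expansion

section Automorphism

theorem zetaAut_y : C.zetaAut C.y = algebraMap K C.FunctionField C.ζ * C.y :=
  C.zetaHom_y C.ζ C.ζ_primitive.pow_eq_one

theorem zetaAut_ratFunc (h : RatFunc K) :
    C.zetaAut (algebraMap (RatFunc K) C.FunctionField h)
      = algebraMap (RatFunc K) C.FunctionField h :=
  (C.zetaHom C.ζ C.ζ_primitive.pow_eq_one).commutes h

theorem zetaAut_pow_ratFunc (k : ℕ) (h : RatFunc K) :
    (C.zetaAut ^ k) (algebraMap (RatFunc K) C.FunctionField h)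
      = algebraMap (RatFunc K) C.FunctionField h := by
  induction k with
  | zero => simp
  | succ k ih => rw [pow_succ, AlgEquiv.mul_apply, zetaAut_ratFunc, ih]

theorem zetaAut_pow_y (k : ℕ) :
    (C.zetaAut ^ k) C.y = algebraMap K C.FunctionField (C.ζ ^ k) * C.y := by
  induction k with
  | zero => simp
  | succ k ih =>
    rw [pow_succ, AlgEquiv.mul_apply, zetaAut_y, map_mul, ih, AlgEquiv.commutes, pow_succ, map_mul]
    ring

theorem zetaAut_pow_term (k j : ℕ) (h : RatFunc K) :
    (C.zetaAut ^ k) (algebraMap (RatFunc K) C.FunctionField h * C.y ^ j)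
      = algebraMap K C.FunctionField ((C.ζ ^ j) ^ k) *
        (algebraMap (RatFunc K) C.FunctionField h * C.y ^ j) := by
  rw [map_mul, map_pow, zetaAut_pow_ratFunc, zetaAut_pow_y, mul_pow, ← map_pow, ← pow_mul,
    ← pow_mul, mul_comm k j]
  ring

theorem zetaAut_pow_n : C.zetaAut ^ n = 1 := by
  ext f
  obtain ⟨h, rfl⟩ := C.exists_expansion f
  rw [map_sum]
  refine Finset.sum_congr rfl fun j _ => ?_
  rw [zetaAut_pow_term, ← pow_mul, mul_comm j n, pow_mul, C.ζ_primitive.pow_eq_one]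
  simp

/-- Averaging over the automorphism group extracts one term of the expansion in powers of `y`. -/
theorem sum_zetaAut_pow (h : ℕ → RatFunc K) {j : ℕ} (hj : j < n) :
    ∑ k ∈ Finset.range n, algebraMap K C.FunctionField ((C.ζ ^ j)⁻¹ ^ k) * (C.zetaAut ^ k)
      (∑ i ∈ Finset.range n, algebraMap (RatFunc K) C.FunctionField (h i) * C.y ^ i)
    = (n : C.FunctionField) * (algebraMap (RatFunc K) C.FunctionField (h j) * C.y ^ j) := by
  have h0 : C.ζ ≠ 0 := C.ζ_primitive.ne_zero C.n_pos.ne'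
  have key : ∀ i ∈ Finset.range n,
      ∑ k ∈ Finset.range n, algebraMap K C.FunctionField ((C.ζ ^ j)⁻¹ ^ k) *
        (algebraMap K C.FunctionField ((C.ζ ^ i) ^ k) *
          (algebraMap (RatFunc K) C.FunctionField (h i) * C.y ^ i))
      = if i = j then (n : C.FunctionField) *
          (algebraMap (RatFunc K) C.FunctionField (h i) * C.y ^ i) else 0 := by
    intro i hi
    rw [Finset.mem_range] at hi
    simp_rw [← mul_assoc, ← map_mul, ← mul_pow]
    rw [← Finset.sum_mul, ← Finset.sum_mul, ← map_sum]
    split_ifs with hij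
    · subst hij
      rw [inv_mul_cancel₀ (pow_ne_zero _ h0)]
      simp
    · have h1 : (C.ζ ^ j)⁻¹ * C.ζ ^ i ≠ 1 := by
        intro h1
        apply hij
        apply C.ζ_primitive.pow_inj hi hj
        rw [inv_mul_eq_one₀ (pow_ne_zero _ h0)] at h1
        exact h1.symm
      rw [geom_sum_eq h1, mul_pow, inv_pow, ← pow_mul, ← pow_mul, mul_comm j, mul_comm i, pow_mul,
        pow_mul, C.ζ_primitive.pow_eq_one]
      simp
  simp_rw [map_sum, zetaAut_pow_term, Finset.mul_sum]
  rw [Finset.sum_comm, Finset.sum_congr rfl key, Finset.sum_ite_eq' _ j, if_pos (by simpa using hj)]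

/-- A primitive `n`-th root of unity exists in a field only if the characteristic does not divide
`n`. This permits averaging over the group. -/
theorem natCast_ne_zero (C : SuperellipticCurve K n d) : (n : K) ≠ 0 := by
  have : NeZero n := ⟨C.n_pos.ne'⟩
  exact (C.ζ_primitive.neZero').out

theorem natCast_ne_zero' : (n : C.FunctionField) ≠ 0 := by
  rw [← map_natCast (algebraMap K C.FunctionField)]
  exact (_root_.map_ne_zero _).2 C.natCast_ne_zero

/-- Averaging leaves an invariant `f` unchanged and also projects it onto its `y ^ 0` term. -/
theorem exists_ratFunc_of_zetaAut_eq {f : C.FunctionField} (hf : C.zetaAut f = f) :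
    ∃ h, f = algebraMap (RatFunc K) C.FunctionField h := by
  obtain ⟨h, hh⟩ := C.exists_expansion f
  refine ⟨h 0, mul_left_cancel₀ C.natCast_ne_zero' ?_⟩
  have h1 : ∀ k, (C.zetaAut ^ k) f = f := by
    intro k
    induction k with
    | zero => simp
    | succ k ih => rw [pow_succ, AlgEquiv.mul_apply, hf, ih]
  have h2 := C.sum_zetaAut_pow h C.n_pos
  rw [← hh] at h2
  simp only [h1] at h2
  simpa using h2

/-- Each term is an average of the conjugates with constant weights, and `n` is a unit at `Q`, so a
bound on all conjugates passes to each term. This reduces Riemann-Roch spaces of invariant divisors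
to eigenfunctions. -/
theorem val_term_le (Q : C.Pt) {h : ℕ → RatFunc K} {B : ℤᵐ⁰}
    (hB : ∀ k, Q.val ((C.zetaAut ^ k)
      (∑ i ∈ Finset.range n, algebraMap (RatFunc K) C.FunctionField (h i) * C.y ^ i)) ≤ B)
    {j : ℕ} (hj : j < n) :
    Q.val (algebraMap (RatFunc K) C.FunctionField (h j) * C.y ^ j) ≤ B := by
  have h1 : Q.val (n : C.FunctionField) = 1 := by
    rw [← map_natCast (algebraMap K C.FunctionField)]
    exact Q.val_algebraMap C.natCast_ne_zero
  have h2 := congrArg Q.val (C.sum_zetaAut_pow h hj)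
  rw [map_mul, h1, one_mul] at h2
  rw [← h2]
  refine Valuation.map_sum_le _ fun k _ => ?_
  rw [map_mul]
  exact (mul_le_mul' (Q.val_const_le _) (hB k)).trans_eq (one_mul _)

end Automorphism

end SuperellipticCurve

namespace SuperellipticCurve

variable {K : Type*} [Field K] {n d : ℕ} (C : SuperellipticCurve K n d)

/-! ### Polynomial functions, coordinates of finite points, and local parameters -/

section Polynomials

/-- Polynomials in `x` as functions on the curve. -/
def ofPoly : K[X] →+* C.FunctionField :=
  (algebraMap (RatFunc K) C.FunctionField).comp (algebraMap K[X] (RatFunc K))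

theorem ofPoly_X : C.ofPoly X = C.x := by
  simp [ofPoly, x]

theorem ofPoly_C (c : K) : C.ofPoly (Polynomial.C c) = algebraMap K C.FunctionField c := by
  rw [IsScalarTower.algebraMap_apply K (RatFunc K) C.FunctionField,
    IsScalarTower.algebraMap_apply K K[X] (RatFunc K)]
  rfl

theorem ofPoly_ne_zero {p : K[X]} (hp : p ≠ 0) : C.ofPoly p ≠ 0 := by
  rw [ofPoly, RingHom.comp_apply]
  refine (_root_.map_ne_zero _).2 ?_
  simpa using hp

theorem ofPoly_eq_aeval (p : K[X]) : C.ofPoly p = aeval C.x p := by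
  have : C.ofPoly = (aeval C.x : K[X] →ₐ[K] C.FunctionField).toRingHom := by
    ext c
    · simp [ofPoly_C]
    · simp [ofPoly_X]
  exact RingHom.congr_fun this p

theorem y_pow_eq_ofPoly : C.y ^ n = C.ofPoly C.rhs := C.y_pow

theorem ratFunc_eq_div (h : RatFunc K) : algebraMap (RatFunc K) C.FunctionField h
    = C.ofPoly h.num / C.ofPoly h.denom := by
  conv_lhs => rw [← RatFunc.num_div_denom h]
  rw [map_div₀]
  rfl

/-- Polynomials in `x` and `y` as functions on the curve. -/
def ofPoly₂ : K[X][X] →+* C.FunctionField := eval₂RingHom C.ofPoly C.y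

theorem ofPoly₂_C (p : K[X]) : C.ofPoly₂ (Polynomial.C p) = C.ofPoly p := by
  simp [ofPoly₂]

theorem ofPoly₂_X : C.ofPoly₂ X = C.y := by
  simp [ofPoly₂]

theorem exists_mul_ofPoly₂_eq (f : C.FunctionField) :
    ∃ p q : K[X][X], C.ofPoly₂ q ≠ 0 ∧ f * C.ofPoly₂ q = C.ofPoly₂ p := by
  obtain ⟨h, rfl⟩ := C.exists_expansion f
  refine Finset.sum_induction _
    (fun f => ∃ p q : K[X][X], C.ofPoly₂ q ≠ 0 ∧ f * C.ofPoly₂ q = C.ofPoly₂ p) ?_ ?_ ?_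
  · rintro f g ⟨p, q, hq, hf⟩ ⟨p', q', hq', hg⟩
    refine ⟨p * q' + p' * q, q * q', ?_, ?_⟩
    · rw [map_mul]; exact mul_ne_zero hq hq'
    · rw [map_add, map_mul, map_mul, map_mul, ← hf, ← hg]
      ring
  · exact ⟨0, 1, by simp, by simp⟩
  · intro j _
    have h0 : C.ofPoly (h j).denom ≠ 0 := C.ofPoly_ne_zero (h j).denom_ne_zero
    refine ⟨Polynomial.C (h j).num * X ^ j, Polynomial.C (h j).denom, ?_, ?_⟩
    · rwa [ofPoly₂_C]
    · rw [ratFunc_eq_div, map_mul, map_pow, ofPoly₂_C, ofPoly₂_C, ofPoly₂_X]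
      field_simp

end Polynomials

section FinitePoints

/-- A product of linear factors in `z` is at least `1` at `P` if all the factors are. -/
theorem _root_.FunctionFieldCurve.Point.one_le_val_aeval [IsAlgClosed K] {F : Type*} [Field F]
    [Algebra K F] (P : Point K F) (z : F) (hz : ∀ b : K, 1 ≤ P.val (z - algebraMap K F b)) {p : K[X]}
    (hp : p ≠ 0) : 1 ≤ P.val (aeval z p) := by
  have h := (IsAlgClosed.splits p).eq_prod_roots
  rw [h, map_mul, aeval_C, map_mul, P.val_algebraMap (leadingCoeff_ne_zero.2 hp), one_mul,
    map_multiset_prod, map_multiset_prod, Multiset.map_map, Multiset.map_map]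
  refine Multiset.one_le_prod_of_one_le ?_
  intro w hw
  obtain ⟨b, -, rfl⟩ := Multiset.mem_map.1 hw
  simpa using hz b

theorem _root_.FunctionFieldCurve.Point.val_le_one_of_sub_lt {F : Type*} [Field F]
    [Algebra K F] {P : Point K F} {z : F} {c : K} (hz : P.val (z - algebraMap K F c) < 1) :
    P.val z ≤ 1 := by
  have := P.val.map_add (z - algebraMap K F c) (algebraMap K F c)
  rw [sub_add_cancel] at this
  exact this.trans (max_le hz.le (P.val_const_le c))

theorem _root_.FunctionFieldCurve.Point.val_aeval_le_one {F : Type*} [Field F]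
    [Algebra K F] {P : Point K F} {z : F} (hz : P.val z ≤ 1) (p : K[X]) :
    P.val (aeval z p) ≤ 1 := by
  rw [← P.mem_ring_iff, aeval_eq_sum_range]
  refine sum_mem fun i _ => ?_
  rw [Algebra.smul_def]
  exact mul_mem (P.algebraMap_mem _) (pow_mem ((P.mem_ring_iff _).2 hz) _)

theorem _root_.FunctionFieldCurve.Point.val_aeval_sub_lt {F : Type*} [Field F]
    [Algebra K F] {P : Point K F} {z : F} {c : K} (hz : P.val (z - algebraMap K F c) < 1)
    (p : K[X]) : P.val (aeval z p - algebraMap K F (p.eval c)) < 1 := by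
  obtain ⟨q, hq⟩ := X_sub_C_dvd_sub_C_eval (p := p) (a := c)
  have h1 : aeval z p - algebraMap K F (p.eval c) = (z - algebraMap K F c) * aeval z q := by
    have := congrArg (aeval z) hq
    simpa using this
  rw [h1, map_mul]
  exact mul_lt_one_of_lt_of_le hz (Point.val_aeval_le_one (Point.val_le_one_of_sub_lt hz) q)

theorem val_ofPoly_le_one {P : C.Pt} (hx : P.val C.x ≤ 1) (p : K[X]) :
    P.val (C.ofPoly p) ≤ 1 := by
  rw [ofPoly_eq_aeval]
  exact Point.val_aeval_le_one hx p

/-- The point `P` lies over the point `x = a` of the line. -/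
def IsOver (P : C.Pt) (a : K) : Prop := P.val (C.x - algebraMap K C.FunctionField a) < 1

/-- The point `P` has coordinates `(a, b)`. -/
def HasCoords (P : C.Pt) (a b : K) : Prop :=
  C.IsOver P a ∧ P.val (C.y - algebraMap K C.FunctionField b) < 1

variable {C}

theorem IsOver.val_x_le_one {P : C.Pt} {a : K} (h : C.IsOver P a) : P.val C.x ≤ 1 :=
  Point.val_le_one_of_sub_lt h

theorem IsOver.val_ofPoly_sub_lt {P : C.Pt} {a : K} (h : C.IsOver P a) (p : K[X]) :
    P.val (C.ofPoly p - algebraMap K C.FunctionField (p.eval a)) < 1 := by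
  rw [ofPoly_eq_aeval]
  exact Point.val_aeval_sub_lt h p

theorem _root_.FunctionFieldCurve.Point.val_eq_one_of_sub_lt {F : Type*} [Field F]
    [Algebra K F] {P : Point K F} {z : F} {c : K} (hc : c ≠ 0)
    (hz : P.val (z - algebraMap K F c) < 1) : P.val z = 1 := by
  rw [← P.val_algebraMap hc] at hz ⊢
  exact Valuation.map_eq_of_sub_lt _ hz

theorem _root_.FunctionFieldCurve.Point.eq_of_sub_lt {F : Type*} [Field F]
    [Algebra K F] {P : Point K F} {z : F} {b c : K} (hb : P.val (z - algebraMap K F b) < 1)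
    (hc : P.val (z - algebraMap K F c) < 1) : b = c := by
  by_contra hbc
  have h1 : P.val (algebraMap K F (b - c)) = 1 := P.val_algebraMap (sub_ne_zero.2 hbc)
  have h2 := P.val.map_sub (z - algebraMap K F c) (z - algebraMap K F b)
  have h3 : (z - algebraMap K F c) - (z - algebraMap K F b) = algebraMap K F (b - c) := by
    rw [map_sub]; ring
  rw [h3, h1] at h2
  exact absurd h2 (not_le.2 (max_lt hc hb))

theorem IsOver.unique {P : C.Pt} {a b : K} (ha : C.IsOver P a) (hb : C.IsOver P b) : a = b :=
  Point.eq_of_sub_lt ha hb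

/-- If every `x - b` were a unit at `P`, all nonzero polynomials in `x` would be units, and `P`
would be trivial on `K(x)`. -/
theorem exists_isOver [IsAlgClosed K] {P : C.Pt} (hx : P.val C.x ≤ 1) : ∃ a, C.IsOver P a := by
  by_contra! hcon
  have h1 : ∀ b : K, 1 ≤ P.val (C.x - algebraMap K C.FunctionField b) := fun b =>
    not_lt.1 (hcon b)
  have h2 : ∀ p : K[X], p ≠ 0 → P.val (C.ofPoly p) = 1 := by
    intro p hp
    refine le_antisymm (C.val_ofPoly_le_one hx p) ?_
    rw [ofPoly_eq_aeval]
    exact P.one_le_val_aeval C.x h1 hp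
  have h3 : ∀ h : RatFunc K, P.val (algebraMap (RatFunc K) C.FunctionField h) ≤ 1 := by
    intro h
    rw [ratFunc_eq_div, map_div₀, h2 _ h.denom_ne_zero, div_one]
    exact C.val_ofPoly_le_one hx _
  obtain ⟨h, hh⟩ := P.exists_one_lt_val_algebraMap (E := RatFunc K)
  exact absurd hh (not_lt.2 (h3 h))

theorem _root_.FunctionFieldCurve.Point.exists_isRoot_of_val_lt [IsAlgClosed K] {F : Type*}
    [Field F] [Algebra K F] {P : Point K F} {z : F} {p : K[X]} (hp : p ≠ 0)
    (h : P.val (aeval z p) < 1) : ∃ b, p.eval b = 0 ∧ P.val (z - algebraMap K F b) < 1 := by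
  by_cases hcon : ∃ b, P.val (z - algebraMap K F b) < 1
  · obtain ⟨b, hb⟩ := hcon
    refine ⟨b, Point.eq_of_sub_lt (Point.val_aeval_sub_lt hb p) ?_, hb⟩
    rwa [map_zero, sub_zero]
  · push Not at hcon
    exact absurd h (not_lt.2 (P.one_le_val_aeval z hcon hp))

/-- Modulo the maximal ideal, `y` is a root of `Y ^ n - rhs(a)`, which splits over `K`. -/
theorem IsOver.exists_hasCoords [IsAlgClosed K] {P : C.Pt} {a : K} (h : C.IsOver P a) :
    ∃ b, b ^ n = C.rhs.eval a ∧ C.HasCoords P a b := by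
  have h1 : P.val (aeval C.y (X ^ n - Polynomial.C (C.rhs.eval a))) < 1 := by
    have h2 : aeval C.y (X ^ n - Polynomial.C (C.rhs.eval a))
        = C.ofPoly C.rhs - algebraMap K C.FunctionField (C.rhs.eval a) := by
      rw [map_sub, map_pow, aeval_X, aeval_C, y_pow_eq_ofPoly]
    rw [h2]
    exact h.val_ofPoly_sub_lt _
  obtain ⟨b, hb, hb'⟩ := Point.exists_isRoot_of_val_lt (X_pow_sub_C_ne_zero C.n_pos _) h1
  refine ⟨b, ?_, h, hb'⟩
  simpa [sub_eq_zero] using hb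

theorem HasCoords.val_ofPoly₂_sub_lt {P : C.Pt} {a b : K} (h : C.HasCoords P a b) (p : K[X][X]) :
    P.val (C.ofPoly₂ p - algebraMap K C.FunctionField ((p.eval (Polynomial.C b)).eval a)) < 1 := by
  obtain ⟨q, hq⟩ := X_sub_C_dvd_sub_C_eval (p := p) (a := Polynomial.C b)
  have h1 : C.ofPoly₂ p - C.ofPoly (p.eval (Polynomial.C b))
      = (C.y - algebraMap K C.FunctionField b) * C.ofPoly₂ q := by
    have := congrArg C.ofPoly₂ hq
    simpa [ofPoly₂_C, ofPoly₂_X, ofPoly_C] using this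
  have h2 : P.val (C.ofPoly₂ q) ≤ 1 := by
    rw [ofPoly₂, coe_eval₂RingHom, eval₂_eq_sum_range, ← P.mem_ring_iff]
    refine sum_mem fun i _ => mul_mem ?_ (pow_mem ?_ _)
    · exact (P.mem_ring_iff _).2 (C.val_ofPoly_le_one h.1.val_x_le_one _)
    · exact (P.mem_ring_iff _).2 (Point.val_le_one_of_sub_lt h.2)
  have h3 := h.1.val_ofPoly_sub_lt (p.eval (Polynomial.C b))
  have h5 : P.val (C.ofPoly₂ p - C.ofPoly (p.eval (Polynomial.C b))) < 1 := by
    rw [h1, map_mul]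
    exact mul_lt_one_of_lt_of_le h.2 h2
  have h4 := P.val.map_add_lt h5 h3
  rwa [sub_add_sub_cancel] at h4

variable (C) in
/-- Functions `t` and `u` exhibiting `t` as a local parameter at the coordinates `(a, b)`:
the function `u` is invertible there and every polynomial function that vanishes there becomes
divisible by `t` after multiplication by `u`. -/
structure LocalParameter (a b : K) where
  t : K[X][X]
  u : K[X][X]
  t_eval : (t.eval (Polynomial.C b)).eval a = 0
  u_eval : (u.eval (Polynomial.C b)).eval a ≠ 0
  t_ne_zero : C.ofPoly₂ t ≠ 0
  exists_dvd : ∀ p : K[X][X], (p.eval (Polynomial.C b)).eval a = 0 →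
    ∃ q : K[X][X], C.ofPoly₂ u * C.ofPoly₂ p = C.ofPoly₂ t * C.ofPoly₂ q

theorem HasCoords.val_eq_one {P : C.Pt} {a b : K} (h : C.HasCoords P a b) {p : K[X][X]}
    (hp : (p.eval (Polynomial.C b)).eval a ≠ 0) : P.val (C.ofPoly₂ p) = 1 :=
  Point.val_eq_one_of_sub_lt hp (h.val_ofPoly₂_sub_lt p)

theorem HasCoords.val_lt_one {P : C.Pt} {a b : K} (h : C.HasCoords P a b) {p : K[X][X]}
    (hp : (p.eval (Polynomial.C b)).eval a = 0) : P.val (C.ofPoly₂ p) < 1 := by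
  have := h.val_ofPoly₂_sub_lt p
  rwa [hp, map_zero, sub_zero] at this

namespace LocalParameter

variable {a b : K} (L : LocalParameter C a b)

theorem exists_val_t {P : C.Pt} (h : C.HasCoords P a b) :
    ∃ e : ℕ, 0 < e ∧ P.val (C.ofPoly₂ L.t) = WithZero.exp (-(e : ℤ)) := by
  obtain ⟨m, hm⟩ := P.exists_val_eq_exp L.t_ne_zero
  have h1 := h.val_lt_one L.t_eval
  rw [hm, ← WithZero.exp_zero, WithZero.exp_lt_exp] at h1
  refine ⟨(-m).toNat, by omega, ?_⟩
  rw [hm]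
  congr 1
  omega

/-- Each division by `t` lowers the order of vanishing at `P`, so the process stops at a `q` that
does not vanish at `(a, b)`. The resulting identity no longer mentions `P`, hence computes orders at
every point with these coordinates. -/
theorem exists_pow_mul_eq {P : C.Pt} (h : C.HasCoords P a b) (m : ℕ) : ∀ p : K[X][X],
    P.val (C.ofPoly₂ p) = WithZero.exp (-(m : ℤ)) → ∃ k : ℕ, ∃ q : K[X][X],
      (q.eval (Polynomial.C b)).eval a ≠ 0 ∧
      C.ofPoly₂ L.u ^ k * C.ofPoly₂ p = C.ofPoly₂ L.t ^ k * C.ofPoly₂ q := by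
  induction m using Nat.strong_induction_on with
  | _ m ih =>
    intro p hp
    by_cases hp0 : (p.eval (Polynomial.C b)).eval a = 0
    · obtain ⟨q, hq⟩ := L.exists_dvd p hp0
      obtain ⟨e, he, hte⟩ := L.exists_val_t h
      have h1 := congrArg P.val hq
      rw [map_mul, map_mul, h.val_eq_one L.u_eval, one_mul, hp, hte] at h1
      have hq0 : C.ofPoly₂ q ≠ 0 := by
        intro h0
        rw [h0, map_zero, mul_zero] at h1
        exact WithZero.exp_ne_zero h1
      obtain ⟨l, hl⟩ := P.exists_val_eq_exp hq0
      rw [hl, ← WithZero.exp_add, WithZero.exp_inj] at h1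
      have h2 : l ≤ 0 := by
        by_cases hq1 : (q.eval (Polynomial.C b)).eval a = 0
        · have := h.val_lt_one hq1
          rw [hl, ← WithZero.exp_zero, WithZero.exp_lt_exp] at this
          exact this.le
        · have := h.val_eq_one hq1
          rw [hl, ← WithZero.exp_zero, WithZero.exp_inj] at this
          exact this.le
      obtain ⟨k, q', hq', hk⟩ := ih (-l).toNat (by omega) q (by rw [hl]; congr 1; omega)
      refine ⟨k + 1, q', hq', ?_⟩
      calc C.ofPoly₂ L.u ^ (k + 1) * C.ofPoly₂ p
          = C.ofPoly₂ L.u ^ k * (C.ofPoly₂ L.u * C.ofPoly₂ p) := by ring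
        _ = C.ofPoly₂ L.t * (C.ofPoly₂ L.u ^ k * C.ofPoly₂ q) := by rw [hq]; ring
        _ = _ := by rw [hk]; ring
    · exact ⟨0, p, hp0, by simp⟩

theorem exists_val_ofPoly₂ {P : C.Pt} (h : C.HasCoords P a b) {p : K[X][X]}
    (hp : C.ofPoly₂ p ≠ 0) :
    ∃ k : ℕ, ∀ Q : C.Pt, C.HasCoords Q a b → Q.val (C.ofPoly₂ p) = Q.val (C.ofPoly₂ L.t) ^ k := by
  obtain ⟨m, hm⟩ := P.exists_val_eq_exp hp
  have h2 : m ≤ 0 := by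
    by_cases hq1 : (p.eval (Polynomial.C b)).eval a = 0
    · have := h.val_lt_one hq1
      rw [hm, ← WithZero.exp_zero, WithZero.exp_lt_exp] at this
      exact this.le
    · have := h.val_eq_one hq1
      rw [hm, ← WithZero.exp_zero, WithZero.exp_inj] at this
      exact this.le
  obtain ⟨k, q, hq, hk⟩ := L.exists_pow_mul_eq h (-m).toNat p (by rw [hm]; congr 1; omega)
  refine ⟨k, fun Q hQ => ?_⟩
  have h3 := congrArg Q.val hk
  rwa [map_mul, map_mul, map_pow, map_pow, hQ.val_eq_one L.u_eval, hQ.val_eq_one hq, one_pow,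
    one_mul, mul_one] at h3

theorem exists_val {P : C.Pt} (h : C.HasCoords P a b) {f : C.FunctionField} (hf : f ≠ 0) :
    ∃ k : ℤ, ∀ Q : C.Pt, C.HasCoords Q a b → Q.val f = Q.val (C.ofPoly₂ L.t) ^ k := by
  obtain ⟨p, q, hq, hfq⟩ := C.exists_mul_ofPoly₂_eq f
  have hp : C.ofPoly₂ p ≠ 0 := hfq ▸ mul_ne_zero hf hq
  obtain ⟨k, hk⟩ := L.exists_val_ofPoly₂ h hp
  obtain ⟨l, hl⟩ := L.exists_val_ofPoly₂ h hq
  refine ⟨(k : ℤ) - l, fun Q hQ => ?_⟩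
  have h0 : Q.val (C.ofPoly₂ L.t) ≠ 0 := (Q.val.ne_zero_iff).2 L.t_ne_zero
  rw [zpow_sub₀ h0, zpow_natCast, zpow_natCast, ← hk Q hQ, ← hl Q hQ,
    eq_div_iff ((Q.val.ne_zero_iff).2 hq), ← map_mul, hfq]

/-- Every nonzero function has the order of a power of `t`; for a uniformizer this forces `t` to
have order one. The exponent depends only on the coordinates, so these determine the point. -/
theorem val_t {P : C.Pt} (h : C.HasCoords P a b) :
    P.val (C.ofPoly₂ L.t) = WithZero.exp (-1) := by
  obtain ⟨e, he, hte⟩ := L.exists_val_t h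
  obtain ⟨f, hf⟩ := P.exists_uniformizer
  have hf0 : f ≠ 0 := by
    rintro rfl
    rw [map_zero] at hf
    exact WithZero.exp_ne_zero hf.symm
  obtain ⟨k, hk⟩ := L.exists_val h hf0
  have h1 := hk P h
  rw [hf, hte, ← WithZero.exp_zsmul, WithZero.exp_inj, smul_eq_mul] at h1
  have h2 : (e : ℤ) ∣ 1 := ⟨k, by linarith⟩
  have h3 := Int.eq_one_of_dvd_one (by omega) h2
  rw [hte, h3]

include L in
theorem eq_of_hasCoords {P Q : C.Pt} (hP : C.HasCoords P a b) (hQ : C.HasCoords Q a b) :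
    P = Q := by
  refine Point.ext_val fun f => ?_
  rcases eq_or_ne f 0 with rfl | hf
  · simp
  obtain ⟨k, hk⟩ := L.exists_val hP hf
  rw [hk P hP, hk Q hQ, L.val_t hP, L.val_t hQ]

end LocalParameter

end FinitePoints

end SuperellipticCurve

namespace SuperellipticCurve

variable {K : Type*} [Field K] {n d : ℕ} {C : SuperellipticCurve K n d}

/-! ### Explicit local parameters at the finite points -/

section LocalParameters

theorem exists_eq_add_mul (p : K[X][X]) {a b : K} (hp : (p.eval (Polynomial.C b)).eval a = 0) :
    ∃ (r : K[X]) (q : K[X][X]), p = Polynomial.C ((X - Polynomial.C a) * r)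
      + (X - Polynomial.C (Polynomial.C b)) * q := by
  obtain ⟨q, hq⟩ := X_sub_C_dvd_sub_C_eval (p := p) (a := Polynomial.C b)
  obtain ⟨r, hr⟩ := dvd_iff_isRoot.2 hp
  refine ⟨r, q, ?_⟩
  rw [← hq, ← hr]
  ring

variable (C) in
/-- The local parameter `x - a` at a point where `y` does not vanish. -/
def localParameterX {a b : K} (hb : b ≠ 0) (hab : b ^ n = C.rhs.eval a) :
    LocalParameter C a b where
  t := Polynomial.C (X - Polynomial.C a)
  -- This is `(y ^ n - b ^ n) / (y - b)`, of value `n b ^ (n - 1)` at the point. On the curve, `u (y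
  -- - b) = rhs(x) - rhs(a)` is divisible by `x - a`.
  u := ∑ i ∈ Finset.range n, X ^ i * (Polynomial.C (Polynomial.C b)) ^ (n - 1 - i)
  t_eval := by simp
  u_eval := by
    simp only [eval_finsetSum, eval_mul, eval_pow, eval_X, eval_C]
    rw [geom_sum₂_self]
    exact mul_ne_zero C.natCast_ne_zero (pow_ne_zero _ hb)
  t_ne_zero := by
    rw [ofPoly₂_C]
    exact C.ofPoly_ne_zero (X_sub_C_ne_zero a)
  exists_dvd p hp := by
    obtain ⟨r, q, rfl⟩ := exists_eq_add_mul p hp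
    obtain ⟨w, hw⟩ := X_sub_C_dvd_sub_C_eval (p := C.rhs) (a := a)
    have h1 := geom_sum₂_mul (X : K[X][X]) (Polynomial.C (Polynomial.C b)) n
    set u := ∑ i ∈ Finset.range n, X ^ i * (Polynomial.C (Polynomial.C b : K[X])) ^ (n - 1 - i)
    refine ⟨u * Polynomial.C r + Polynomial.C w * q, ?_⟩
    have h2 := congrArg C.ofPoly₂ h1
    rw [map_sub, map_pow, ofPoly₂_X, y_pow_eq_ofPoly, ← map_pow, ← map_pow, hab, ofPoly₂_C,
      ← map_sub, hw, map_mul, map_mul] at h2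
    simp only [map_add, map_mul, ofPoly₂_C] at h2 ⊢
    linear_combination C.ofPoly₂ q * h2

theorem eval_rhs_eq_zero_iff {a : K} : C.rhs.eval a = 0 ↔ ∃ i, a = -C.α i := by
  simp [rhs, eval_prod, Finset.prod_eq_zero_iff, eq_neg_iff_add_eq_zero]

theorem natDegree_rhs : C.rhs.natDegree = d := by
  rw [rhs, natDegree_prod_of_monic _ _ fun _ _ => monic_X_add_C _]
  simp

theorem rhs_ne_zero : C.rhs ≠ 0 :=
  (monic_prod_of_monic _ _ fun _ _ => monic_X_add_C _).ne_zero

variable (C) in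
/-- The product of the factors of the right hand side other than the one of index `i`. -/
def rhsErase (i : Fin d) : K[X] := ∏ j ∈ Finset.univ.erase i, (X + Polynomial.C (C.α j))

theorem mul_rhsErase (i : Fin d) : (X - Polynomial.C (-C.α i)) * C.rhsErase i = C.rhs := by
  rw [map_neg, sub_neg_eq_add, rhsErase, rhs]
  exact Finset.mul_prod_erase Finset.univ (fun j => X + Polynomial.C (C.α j)) (Finset.mem_univ i)

theorem eval_rhsErase_ne_zero (i : Fin d) : (C.rhsErase i).eval (-C.α i) ≠ 0 := by
  rw [rhsErase, eval_prod, Finset.prod_ne_zero_iff]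
  intro j hj h
  refine (Finset.mem_erase.1 hj).1 (C.α_injective ?_)
  simp only [eval_add, eval_X, eval_C] at h
  linear_combination h

variable (C) in
/-- The local parameter `y` at a branch point. -/
def localParameterY (i : Fin d) : LocalParameter C (-C.α i) 0 where
  t := X
  -- On the curve `u (x + α_i) = y ^ n`, so this factor makes `x + α_i` divisible by `y`.
  u := Polynomial.C (C.rhsErase i)
  t_eval := by simp
  u_eval := by simpa using eval_rhsErase_ne_zero i
  t_ne_zero := by
    rw [ofPoly₂_X]
    exact C.y_ne_zero
  exists_dvd p hp := by
    obtain ⟨r, q, rfl⟩ := exists_eq_add_mul p hp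
    refine ⟨X ^ (n - 1) * Polynomial.C r + Polynomial.C (C.rhsErase i) * q, ?_⟩
    have h1 : C.y * C.y ^ (n - 1) = C.ofPoly (X - Polynomial.C (-C.α i)) * C.ofPoly (C.rhsErase i) := by
      rw [← map_mul, mul_rhsErase, ← y_pow_eq_ofPoly, mul_pow_sub_one C.n_pos.ne']
    simp only [map_add, map_sub, map_mul, map_pow, ofPoly₂_C, ofPoly₂_X, map_zero] at h1 ⊢
    linear_combination -C.ofPoly r * h1

end LocalParameters

/-! ### Fibres of `x` over finite values: existence, ramification, action of `ζ` -/

section Values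

variable {P Q : C.Pt}

theorem val_image_sub (k : ℕ) (a : K) (P : C.Pt) :
    (P.image (C.zetaAut ^ k)).val (C.x - algebraMap K C.FunctionField a)
      = P.val (C.x - algebraMap K C.FunctionField a) := by
  rw [Point.val_image, map_sub, AlgEquiv.commutes, x, zetaAut_pow_ratFunc]

theorem isOver_image {a : K} (k : ℕ) : C.IsOver (P.image (C.zetaAut ^ k)) a ↔ C.IsOver P a := by
  rw [IsOver, IsOver, val_image_sub]

theorem HasCoords.image {a b : K} (h : C.HasCoords P a b) (k : ℕ) :
    C.HasCoords (P.image (C.zetaAut ^ k)) a (C.ζ ^ k * b) := by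
  refine ⟨(isOver_image k).2 h.1, ?_⟩
  have h1 : P.val (algebraMap K C.FunctionField (C.ζ ^ k)) = 1 :=
    P.val_algebraMap (pow_ne_zero _ (C.ζ_primitive.ne_zero C.n_pos.ne'))
  rw [Point.val_image, map_sub, AlgEquiv.commutes, zetaAut_pow_y, map_mul (algebraMap _ _),
    ← mul_sub, map_mul, h1, one_mul]
  exact h.2

/-- Extend the place `x = a` of `K(x)`; characteristic zero supplies the separability needed by
`Point.exists_over`. -/
theorem exists_point_isOver [CharZero K] (C : SuperellipticCurve K n d) (a : K) :
    ∃ P : C.Pt, C.IsOver P a := by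
  have : CharZero (RatFunc K) := charZero_of_injective_algebraMap (algebraMap K (RatFunc K)).injective
  let w : IsDedekindDomain.HeightOneSpectrum K[X] :=
    ⟨Ideal.span {X - Polynomial.C a}, (Ideal.span_singleton_prime (X_sub_C_ne_zero a)).2
      (prime_X_sub_C a), by simpa using X_sub_C_ne_zero a⟩
  have hw : w.valuation (RatFunc K) (algebraMap K[X] (RatFunc K) (X - Polynomial.C a)) < 1 := by
    rw [IsDedekindDomain.HeightOneSpectrum.valuation_lt_one_iff_mem]
    exact Ideal.mem_span_singleton_self _
  have h0 : algebraMap K[X] (RatFunc K) (X - Polynomial.C a) ≠ 0 := by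
    exact (_root_.map_ne_zero_iff _ (IsFractionRing.injective K[X] (RatFunc K))).2
      (X_sub_C_ne_zero a)
  let V : Point K (RatFunc K) := Point.ofValuation (w.valuation (RatFunc K))
    (fun c => w.valuation_le_one (K := RatFunc K) (Polynomial.C c)) ⟨_, (Valuation.ne_zero_iff _).2 h0, hw.ne⟩
  obtain ⟨Q, hQ⟩ := V.exists_over (F := C.FunctionField)
  refine ⟨Q, ?_⟩
  -- Only the relation `≤ 1` is transported, so the strict bound on `x - a` is obtained from its
  -- inverse.
  have h1 := (hQ (algebraMap K[X] (RatFunc K) (X - Polynomial.C a))⁻¹).not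
  rw [Point.ofValuation_val_le_one_iff, map_inv₀, map_inv₀, map_inv₀] at h1
  have h2 : algebraMap (RatFunc K) C.FunctionField (algebraMap K[X] (RatFunc K) (X - Polynomial.C a))
      = C.x - algebraMap K C.FunctionField a := by
    rw [← ofPoly_X, ← ofPoly_C, ← map_sub]
    rfl
  rw [h2, inv_le_one₀ (zero_lt_iff.2 ((Valuation.ne_zero_iff _).2 h0)), inv_le_one₀ (zero_lt_iff.2
    ((Q.val.ne_zero_iff).2 (by rw [← h2]; exact (_root_.map_ne_zero _).2 h0))), not_le, not_le] at h1
  exact h1.1 hw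

variable [IsAlgClosed K]

theorem IsOver.val_sub_of_eval_ne_zero {a : K} (h : C.IsOver P a) (ha : C.rhs.eval a ≠ 0) :
    P.val (C.x - algebraMap K C.FunctionField a) = WithZero.exp (-1) := by
  obtain ⟨b, hb, hab⟩ := h.exists_hasCoords
  have hb0 : b ≠ 0 := by
    rintro rfl
    rw [zero_pow C.n_pos.ne'] at hb
    exact ha hb.symm
  have h1 := (C.localParameterX hb0 hb).val_t hab
  simpa [localParameterX, ofPoly₂_C, ofPoly_X, ofPoly_C] using h1

theorem IsOver.val_y_of_eval_ne_zero {a : K} (h : C.IsOver P a) (ha : C.rhs.eval a ≠ 0) :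
    P.val C.y = 1 := by
  obtain ⟨b, hb, hab⟩ := h.exists_hasCoords
  refine Point.val_eq_one_of_sub_lt (c := b) ?_ hab.2
  rintro rfl
  rw [zero_pow C.n_pos.ne'] at hb
  exact ha hb.symm

theorem IsOver.hasCoords_zero {i : Fin d} (h : C.IsOver P (-C.α i)) :
    C.HasCoords P (-C.α i) 0 := by
  obtain ⟨b, hb, hab⟩ := h.exists_hasCoords
  rw [eval_rhs_eq_zero_iff.2 ⟨i, rfl⟩, pow_eq_zero_iff C.n_pos.ne'] at hb
  rwa [hb] at hab

theorem IsOver.val_y_of_branch {i : Fin d} (h : C.IsOver P (-C.α i)) :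
    P.val C.y = WithZero.exp (-1) := by
  have h1 := (C.localParameterY i).val_t h.hasCoords_zero
  simpa [localParameterY, ofPoly₂_X] using h1

/-- Total ramification: `y ^ n` is `x + α_i` times a unit, and `y` is a uniformizer. -/
theorem IsOver.val_sub_of_branch {i : Fin d} (h : C.IsOver P (-C.α i)) :
    P.val (C.x - algebraMap K C.FunctionField (-C.α i)) = WithZero.exp (-(n : ℤ)) := by
  have h1 : C.y ^ n = (C.x - algebraMap K C.FunctionField (-C.α i)) * C.ofPoly (C.rhsErase i) := by
    rw [y_pow_eq_ofPoly, ← mul_rhsErase i, map_mul, map_sub, ofPoly_X, ofPoly_C]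
  have h2 := congrArg P.val h1
  rw [map_mul, map_pow, h.val_y_of_branch, Point.val_eq_one_of_sub_lt (eval_rhsErase_ne_zero i)
    (h.val_ofPoly_sub_lt _), mul_one, ← WithZero.exp_nsmul] at h2
  rw [← h2]
  simp

theorem IsOver.eq_of_branch {i : Fin d} (hP : C.IsOver P (-C.α i)) (hQ : C.IsOver Q (-C.α i)) :
    P = Q :=
  (C.localParameterY i).eq_of_hasCoords hP.hasCoords_zero hQ.hasCoords_zero

/-- The automorphism group acts transitively on the points over an unbranched value of `x`. -/
theorem IsOver.exists_image_eq {a : K} (ha : C.rhs.eval a ≠ 0) (hP : C.IsOver P a)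
    (hQ : C.IsOver Q a) : ∃ k < n, P.image (C.zetaAut ^ k) = Q := by
  obtain ⟨b, hb, hab⟩ := hP.exists_hasCoords
  obtain ⟨c, hc, hac⟩ := hQ.exists_hasCoords
  have hb0 : b ≠ 0 := by
    rintro rfl
    rw [zero_pow C.n_pos.ne'] at hb
    exact ha hb.symm
  have hc0 : c ≠ 0 := by
    rintro rfl
    rw [zero_pow C.n_pos.ne'] at hc
    exact ha hc.symm
  have : NeZero n := ⟨C.n_pos.ne'⟩
  obtain ⟨k, hk, hkc⟩ := C.ζ_primitive.eq_pow_of_pow_eq_one (ξ := c / b) (by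
    rw [div_pow, hb, hc, div_self ha])
  refine ⟨k, hk, (C.localParameterX hc0 hc).eq_of_hasCoords ?_ hac⟩
  have := hab.image k
  rwa [hkc, div_mul_cancel₀ _ hb0] at this

theorem IsOver.image_injOn {a : K} (ha : C.rhs.eval a ≠ 0) (hP : C.IsOver P a) {k l : ℕ}
    (hk : k < n) (hl : l < n) (h : P.image (C.zetaAut ^ k) = P.image (C.zetaAut ^ l)) : k = l := by
  obtain ⟨b, hb, hab⟩ := hP.exists_hasCoords
  have hb0 : b ≠ 0 := by
    rintro rfl
    rw [zero_pow C.n_pos.ne'] at hb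
    exact ha hb.symm
  have h1 := (hab.image k).2
  rw [h] at h1
  have h2 := Point.eq_of_sub_lt h1 (hab.image l).2
  exact C.ζ_primitive.pow_inj hk hl (mul_right_cancel₀ hb0 h2)

theorem IsOver.image_eq_of_branch {i : Fin d} (hP : C.IsOver P (-C.α i)) (k : ℕ) :
    P.image (C.zetaAut ^ k) = P :=
  ((isOver_image k).2 hP).eq_of_branch hP

end Values

end SuperellipticCurve

namespace SuperellipticCurve

variable {K : Type*} [Field K] {n d : ℕ} {C : SuperellipticCurve K n d}

/-! ### The unique point at infinity -/

section Infinity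

variable {P Q : C.Pt}

theorem isAtInfinity_iff : C.IsAtInfinity P ↔ 1 < P.val C.x := by
  rw [IsAtInfinity, P.mem_ring_iff, not_le]

theorem exists_isAtInfinity [CharZero K] (C : SuperellipticCurve K n d) :
    ∃ P : C.Pt, C.IsAtInfinity P := by
  classical
  have : CharZero (RatFunc K) := charZero_of_injective_algebraMap (algebraMap K (RatFunc K)).injective
  have hX : RatFunc.inftyValuation K RatFunc.X = WithZero.exp 1 :=
    RatFunc.inftyValuation.X K
  have hX1 : 1 < RatFunc.inftyValuation K RatFunc.X := by
    rw [hX, ← WithZero.exp_zero, WithZero.exp_lt_exp]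
    norm_num
  let V : Point K (RatFunc K) := Point.ofValuation (RatFunc.inftyValuation K)
    (fun c => by
      rcases eq_or_ne c 0 with rfl | hc
      · simp
      · exact (RatFunc.inftyValuation.C K hc).le) ⟨RatFunc.X, by rw [hX]; simp, hX1.ne'⟩
  obtain ⟨Q, hQ⟩ := V.exists_over (F := C.FunctionField)
  refine ⟨Q, isAtInfinity_iff.2 ?_⟩
  have h1 := (hQ RatFunc.X).not
  rw [Point.ofValuation_val_le_one_iff, not_le, not_le] at h1
  exact h1.1 hX1

theorem IsAtInfinity.not_isOver (hP : C.IsAtInfinity P) (a : K) : ¬ C.IsOver P a := fun h =>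
  absurd (isAtInfinity_iff.1 hP) (not_lt.2 h.val_x_le_one)

variable [IsAlgClosed K]

theorem isAtInfinity_or_isOver (P : C.Pt) : C.IsAtInfinity P ∨ ∃ a, C.IsOver P a := by
  by_cases h : P.val C.x ≤ 1
  · exact Or.inr (exists_isOver h)
  · exact Or.inl (isAtInfinity_iff.2 (not_le.1 h))

theorem IsAtInfinity.val_ofPoly (hP : C.IsAtInfinity P) {p : K[X]} (hp : p ≠ 0) :
    P.val (C.ofPoly p) = P.val C.x ^ p.natDegree := by
  have h1 : ∀ b : K, P.val (C.x - algebraMap K C.FunctionField b) = P.val C.x := fun b =>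
    Valuation.map_sub_eq_of_lt_left _ ((P.val_const_le b).trans_lt (isAtInfinity_iff.1 hP))
  have h := (IsAlgClosed.splits p).eq_prod_roots
  have h2 := (IsAlgClosed.splits p).natDegree_eq_card_roots
  rw [ofPoly_eq_aeval]
  conv_lhs => rw [h]
  rw [map_mul, aeval_C, map_mul, P.val_algebraMap (leadingCoeff_ne_zero.2 hp), one_mul,
    map_multiset_prod, map_multiset_prod, Multiset.map_map, Multiset.map_map, h2,
    ← Multiset.prod_replicate, ← Multiset.map_const']
  refine congrArg Multiset.prod (Multiset.map_congr rfl fun b _ => ?_)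
  simpa using h1 b

theorem IsAtInfinity.val_ratFunc (hP : C.IsAtInfinity P) {h : RatFunc K} (hh : h ≠ 0) :
    P.val (algebraMap (RatFunc K) C.FunctionField h) = P.val C.x ^ h.intDegree := by
  have h0 : P.val C.x ≠ 0 := (zero_lt_one.trans (isAtInfinity_iff.1 hP)).ne'
  rw [ratFunc_eq_div, map_div₀, hP.val_ofPoly (RatFunc.num_ne_zero hh),
    hP.val_ofPoly h.denom_ne_zero, RatFunc.intDegree, zpow_sub₀ h0, zpow_natCast, zpow_natCast]

/-- The equation of the curve makes `n` times the pole order of `y` equal to `d` times that of `x`;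
coprimality yields the common factor `e`, which later turns out to be `1`. -/
theorem IsAtInfinity.exists_val_x (hP : C.IsAtInfinity P) : ∃ e : ℤ, 0 < e ∧
    P.val C.x = WithZero.exp (n * e) ∧ P.val C.y = WithZero.exp (d * e) := by
  obtain ⟨u, hu⟩ := P.exists_val_eq_exp C.y_ne_zero
  have h1 := isAtInfinity_iff.1 hP
  obtain ⟨v, hv⟩ := P.exists_val_eq_exp (f := C.x) (by rintro h; simp [h] at h1)
  have h2 := congrArg P.val C.y_pow_eq_ofPoly
  rw [map_pow, hP.val_ofPoly rhs_ne_zero, natDegree_rhs, hu, hv, ← WithZero.exp_nsmul,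
    ← WithZero.exp_nsmul, WithZero.exp_inj, nsmul_eq_mul, nsmul_eq_mul] at h2
  have h3 : (n : ℤ) ∣ v := by
    refine Int.dvd_of_dvd_mul_right_of_gcd_one (b := d) ⟨u, h2.symm⟩ ?_
    simpa using C.coprime
  obtain ⟨e, rfl⟩ := h3
  rw [hv, ← WithZero.exp_zero, WithZero.exp_lt_exp] at h1
  have hn : (0 : ℤ) < n := by exact_mod_cast C.n_pos
  refine ⟨e, by nlinarith, hv, ?_⟩
  rw [hu]
  congr 1
  exact mul_left_cancel₀ hn.ne' (by linarith)

/-- The terms of the expansion of `f` have distinct orders, so the dominant one decides. As `m`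
depends only on `f`, two points at infinity have the same local ring. -/
theorem exists_val_at_infinity {f : C.FunctionField} (hf : f ≠ 0) : ∃ m : ℤ,
    ∀ P : C.Pt, C.IsAtInfinity P → ∀ e : ℤ, 0 < e → P.val C.x = WithZero.exp (n * e) →
      P.val C.y = WithZero.exp (d * e) → P.val f = WithZero.exp (e * m) := by
  classical
  obtain ⟨h, rfl⟩ := C.exists_expansion f
  obtain ⟨j, hj, hmax⟩ := ((Finset.range n).filter fun i => h i ≠ 0).exists_max_image
    (fun i => (n : ℤ) * (h i).intDegree + d * i) (by
      by_contra hcon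
      rw [Finset.not_nonempty_iff_eq_empty, Finset.filter_eq_empty_iff] at hcon
      push Not at hcon
      exact hf (Finset.sum_eq_zero fun i hi => by rw [hcon hi]; simp))
  rw [Finset.mem_filter] at hj
  refine ⟨n * (h j).intDegree + d * j, fun P hP e he hx hy => ?_⟩
  have hterm : ∀ i, h i ≠ 0 → P.val (algebraMap (RatFunc K) C.FunctionField (h i) * C.y ^ i)
      = WithZero.exp (e * (n * (h i).intDegree + d * i)) := by
    intro i hi
    rw [map_mul, map_pow, hP.val_ratFunc hi, hx, hy, ← WithZero.exp_zsmul, ← WithZero.exp_nsmul,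
      ← WithZero.exp_add, smul_eq_mul, nsmul_eq_mul]
    congr 1
    ring
  rw [Valuation.map_sum_eq_of_lt P.val hj.1, hterm j hj.2]
  intro i hi
  rw [Finset.mem_sdiff, Finset.mem_singleton] at hi
  rw [hterm j hj.2]
  rcases eq_or_ne (h i) 0 with h0 | h0
  · rw [h0]
    simp
  rw [hterm i h0, WithZero.exp_lt_exp]
  refine mul_lt_mul_of_pos_left (lt_of_le_of_ne (hmax i (by simpa [h0] using hi.1)) fun heq => ?_) he
  -- Equal orders would give `n ∣ d (i - j)`, impossible for distinct exponents below `n` since `d`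
  -- is prime to `n`.
  have h1 : (n : ℤ) ∣ (i - j : ℤ) := by
    refine Int.dvd_of_dvd_mul_right_of_gcd_one (b := d)
      ⟨(h j).intDegree - (h i).intDegree, by linear_combination heq⟩ ?_
    simpa using C.coprime
  have hi' := Finset.mem_range.1 hi.1
  have hj' := Finset.mem_range.1 hj.1
  have h2 := Int.eq_zero_of_abs_lt_dvd h1 (by rw [abs_lt]; omega)
  omega

/-- All orders at `P` are multiples of `e`, and a uniformizer has order one. -/
theorem IsAtInfinity.val_x_and_val_y (hP : C.IsAtInfinity P) :
    P.val C.x = WithZero.exp (n : ℤ) ∧ P.val C.y = WithZero.exp (d : ℤ) := by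
  obtain ⟨e, he, hx, hy⟩ := hP.exists_val_x
  obtain ⟨f, hf⟩ := P.exists_uniformizer
  have hf0 : f ≠ 0 := by
    rintro rfl
    rw [map_zero] at hf
    exact WithZero.exp_ne_zero hf.symm
  obtain ⟨m, hm⟩ := exists_val_at_infinity hf0
  have h1 := hm P hP e he hx hy
  rw [hf, WithZero.exp_inj] at h1
  have h3 : e = 1 := Int.eq_one_of_dvd_one he.le ⟨-m, by linarith⟩
  subst h3
  simpa using And.intro hx hy

theorem IsAtInfinity.val_x (hP : C.IsAtInfinity P) : P.val C.x = WithZero.exp (n : ℤ) :=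
  hP.val_x_and_val_y.1

theorem IsAtInfinity.val_y (hP : C.IsAtInfinity P) : P.val C.y = WithZero.exp (d : ℤ) :=
  hP.val_x_and_val_y.2

theorem IsAtInfinity.eq (hP : C.IsAtInfinity P) (hQ : C.IsAtInfinity Q) : P = Q := by
  refine Point.ext_val fun f => ?_
  rcases eq_or_ne f 0 with rfl | hf
  · simp
  obtain ⟨m, hm⟩ := exists_val_at_infinity hf
  rw [hm P hP 1 one_pos (by simpa using hP.val_x) (by simpa using hP.val_y),
    hm Q hQ 1 one_pos (by simpa using hQ.val_x) (by simpa using hQ.val_y)]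

theorem IsAtInfinity.image (hP : C.IsAtInfinity P) (k : ℕ) :
    P.image (C.zetaAut ^ k) = P := by
  refine IsAtInfinity.eq (isAtInfinity_iff.2 ?_) hP
  have h := C.val_image_sub k 0 P
  rw [map_zero, sub_zero] at h
  rw [h]
  exact isAtInfinity_iff.1 hP

end Infinity

end SuperellipticCurve

/-! ### Calculus of divisors of functions -/

namespace FunctionFieldCurve

variable {K F : Type*} [Field K] [Field F] [Algebra K F]

/-- The divisor of the function `f` is `D`. -/
def HasDiv (f : F) (D : Divisor K F) : Prop := ∀ P : Point K F, P.val f = WithZero.exp (-(D P))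

theorem HasDiv.mul {f g : F} {D E : Divisor K F} (hf : HasDiv f D) (hg : HasDiv g E) :
    HasDiv (f * g) (D + E) := fun P => by
  rw [map_mul, hf, hg, ← WithZero.exp_add, Finsupp.add_apply, neg_add]

theorem HasDiv.inv {f : F} {D : Divisor K F} (hf : HasDiv f D) : HasDiv f⁻¹ (-D) := fun P => by
  rw [map_inv₀, hf, ← WithZero.exp_neg, Finsupp.neg_apply]

theorem HasDiv.div {f g : F} {D E : Divisor K F} (hf : HasDiv f D) (hg : HasDiv g E) :
    HasDiv (f / g) (D - E) := by
  rw [div_eq_mul_inv, sub_eq_add_neg]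
  exact hf.mul hg.inv

theorem hasDiv_algebraMap {c : K} (hc : c ≠ 0) :
    HasDiv (algebraMap K F c) (0 : Divisor K F) := fun P => by
  simp [P.val_algebraMap hc]

theorem hasDiv_one : HasDiv (1 : F) (0 : Divisor K F) := fun P => by simp

theorem HasDiv.pow {f : F} {D : Divisor K F} (hf : HasDiv f D) (m : ℕ) :
    HasDiv (f ^ m) (m • D) := fun P => by
  rw [map_pow, hf, ← WithZero.exp_nsmul, Finsupp.smul_apply, smul_neg]

theorem HasDiv.prod {ι : Type*} (s : Finset ι) {f : ι → F} {D : ι → Divisor K F}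
    (h : ∀ i ∈ s, HasDiv (f i) (D i)) : HasDiv (∏ i ∈ s, f i) (∑ i ∈ s, D i) := by
  classical
  induction s using Finset.induction_on with
  | empty => simpa using hasDiv_one
  | insert i s hi ih =>
    rw [Finset.prod_insert hi, Finset.sum_insert hi]
    exact (h i (Finset.mem_insert_self _ _)).mul (ih fun j hj => h j (Finset.mem_insert_of_mem hj))

theorem HasDiv.unique {f : F} {D E : Divisor K F} (hD : HasDiv f D) (hE : HasDiv f E) : D = E := by
  ext P
  have := (hD P).symm.trans (hE P)
  rw [WithZero.exp_inj] at this
  omega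

theorem divMap_apply_image (σ : F ≃ₐ[K] F) (D : Divisor K F) (P : Point K F) :
    divMap σ D (P.image σ) = D P :=
  Finsupp.mapDomain_apply (Point.perm σ).injective _ _

theorem divMap_symm_apply (σ : F ≃ₐ[K] F) (D : Divisor K F) (P : Point K F) :
    divMap σ.symm D P = D (P.image σ) := by
  have h := divMap_apply_image σ.symm D (P.image σ)
  rw [Point.image_image] at h
  simpa [Point.image_refl] using h

/-- Functions are pulled back while divisors are pushed forward, whence the inverse of `σ`. -/
theorem HasDiv.aut {f : F} {D : Divisor K F} (hf : HasDiv f D) (σ : F ≃ₐ[K] F) :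
    HasDiv (σ f) (divMap σ.symm D) := fun P => by
  rw [divMap_symm_apply, ← Point.val_image, hf]

theorem exists_hasDiv_of_finite {f : F} (hf : f ≠ 0) (h : {P : Point K F | P.val f ≠ 1}.Finite) :
    ∃ D : Divisor K F, HasDiv f D := by
  refine ⟨Finsupp.ofSupportFinite (fun P => -(WithZero.log (P.val f))) (h.subset ?_), fun P => ?_⟩
  · intro P hP h1
    rw [Function.mem_support, h1] at hP
    simp at hP
  · rw [Finsupp.ofSupportFinite_coe, neg_neg, WithZero.exp_log ((P.val.ne_zero_iff).2 hf)]

theorem HasDiv.finite {f : F} {D : Divisor K F} (hf : HasDiv f D) :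
    {P : Point K F | P.val f ≠ 1}.Finite := by
  refine D.hasFiniteSupport.subset fun P hP => ?_
  rw [Function.mem_support]
  intro h
  exact hP (by rw [hf, h]; simp)

theorem mem_principal_iff {D : Divisor K F} : D ∈ principal K F ↔ ∃ f : F, f ≠ 0 ∧ HasDiv f D :=
  Iff.rfl

theorem deg_single (P : Point K F) (m : ℤ) : deg K F (Finsupp.single P m) = m := by
  simp [deg]

/-- An effective divisor of degree zero vanishes. -/
theorem eq_zero_of_deg_eq_zero {D : Divisor K F} (h : ∀ P, 0 ≤ D P) (hD : deg K F D = 0) :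
    D = 0 := by
  have h1 : deg K F D = ∑ P ∈ D.support, D P := by
    simp [deg, Finsupp.liftAddHom_apply, Finsupp.sum]
  rw [h1, Finset.sum_eq_zero_iff_of_nonneg fun P _ => h P] at hD
  ext P
  by_contra hP
  exact hP (hD P (Finsupp.mem_support_iff.2 hP))

end FunctionFieldCurve

namespace SuperellipticCurve

variable {K : Type*} [Field K] {n d : ℕ} (C : SuperellipticCurve K n d)

/-! ### The norm to `K(x)`, divisors of explicit functions, and degree zero -/

section Norm

variable {C}

variable (C) in
/-- The norm of a function down to `K(x)`. -/
def norm (f : C.FunctionField) : C.FunctionField := ∏ k ∈ Finset.range n, (C.zetaAut ^ k) f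

/-- Applying `ζ` permutes the factors of the norm cyclically, since `ζ ^ n = 1`. -/
theorem exists_norm_eq (f : C.FunctionField) :
    ∃ h, C.norm f = algebraMap (RatFunc K) C.FunctionField h := by
  refine C.exists_ratFunc_of_zetaAut_eq ?_
  rw [norm, map_prod]
  have h1 : ∀ k, C.zetaAut ((C.zetaAut ^ k) f) = (C.zetaAut ^ (k + 1)) f := fun k => by
    rw [pow_succ', AlgEquiv.mul_apply]
  obtain ⟨m, rfl⟩ := Nat.exists_eq_succ_of_ne_zero C.n_pos.ne'
  simp_rw [h1]
  rw [Finset.prod_range_succ, C.zetaAut_pow_n, Finset.prod_range_succ']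
  simp

theorem norm_ne_zero {f : C.FunctionField} (hf : f ≠ 0) : C.norm f ≠ 0 :=
  Finset.prod_ne_zero_iff.2 fun k _ => (_root_.map_ne_zero (C.zetaAut ^ k)).2 hf

theorem _root_.FunctionFieldCurve.HasDiv.norm {f : C.FunctionField}
    {D : Divisor K C.FunctionField} (hf : HasDiv f D) :
    HasDiv (C.norm f) (∑ k ∈ Finset.range n, divMap (C.zetaAut ^ k).symm D) :=
  HasDiv.prod _ fun _ _ => hf.aut _

end Norm

section SpecialPoints

variable {C}

theorem IsOver.val_sub_eq_one {P : C.Pt} {a b : K} (h : C.IsOver P a) (hab : a ≠ b) :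
    P.val (C.x - algebraMap K C.FunctionField b) = 1 := by
  refine Point.val_eq_one_of_sub_lt (c := a - b) (sub_ne_zero.2 hab) ?_
  rw [map_sub (algebraMap K C.FunctionField), sub_sub_sub_cancel_right]
  exact h

variable (C)

variable [CharZero K]

/-- The point at infinity. -/
def infty : C.Pt := C.exists_isAtInfinity.choose

theorem isAtInfinity_infty : C.IsAtInfinity C.infty := C.exists_isAtInfinity.choose_spec

/-- The branch point `(-α_i, 0)`. -/
def branch (i : Fin d) : C.Pt := (C.exists_point_isOver (-C.α i)).choose

theorem isOver_branch (i : Fin d) : C.IsOver (C.branch i) (-C.α i) :=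
  (C.exists_point_isOver (-C.α i)).choose_spec

theorem branch_injective : Function.Injective C.branch := by
  intro i j h
  have h1 := C.isOver_branch i
  rw [h] at h1
  exact C.α_injective (neg_injective (h1.unique (C.isOver_branch j)))

theorem branch_ne_infty (i : Fin d) : C.branch i ≠ C.infty := fun h =>
  (C.isAtInfinity_infty).not_isOver _ (h ▸ C.isOver_branch i)

variable {C}

theorem IsOver.ne_infty {P : C.Pt} {a : K} (h : C.IsOver P a) : P ≠ C.infty := fun h' =>
  (C.isAtInfinity_infty).not_isOver _ (h' ▸ h)

theorem IsOver.ne_branch {P : C.Pt} {a : K} (h : C.IsOver P a) (ha : C.rhs.eval a ≠ 0)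
    (i : Fin d) : P ≠ C.branch i := by
  rintro rfl
  exact ha (eval_rhs_eq_zero_iff.2 ⟨i, h.unique (C.isOver_branch i)⟩)

variable [IsAlgClosed K]

variable (C) in
theorem isAtInfinity_iff_eq {P : C.Pt} : C.IsAtInfinity P ↔ P = C.infty :=
  ⟨fun h => h.eq C.isAtInfinity_infty, fun h => h ▸ C.isAtInfinity_infty⟩

theorem IsOver.eq_branch {P : C.Pt} {i : Fin d} (h : C.IsOver P (-C.α i)) : P = C.branch i :=
  h.eq_of_branch (C.isOver_branch i)

/-- The three kinds of points. -/
theorem point_cases (P : C.Pt) : P = C.infty ∨ (∃ i, P = C.branch i) ∨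
    ∃ a, C.rhs.eval a ≠ 0 ∧ C.IsOver P a := by
  rcases isAtInfinity_or_isOver P with h | ⟨a, h⟩
  · exact Or.inl (C.isAtInfinity_iff_eq.1 h)
  · by_cases ha : C.rhs.eval a = 0
    · obtain ⟨i, rfl⟩ := eval_rhs_eq_zero_iff.1 ha
      exact Or.inr (Or.inl ⟨i, h.eq_branch⟩)
    · exact Or.inr (Or.inr ⟨a, ha, h⟩)

theorem val_sub_infty (a : K) :
    C.infty.val (C.x - algebraMap K C.FunctionField a) = WithZero.exp (n : ℤ) := by
  rw [← C.isAtInfinity_infty.val_x]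
  exact Valuation.map_sub_eq_of_lt_left _
    ((Point.val_const_le _ a).trans_lt (isAtInfinity_iff.1 C.isAtInfinity_infty))

theorem hasDiv_sub_branch (i : Fin d) : HasDiv (C.x - algebraMap K C.FunctionField (-C.α i))
    (Finsupp.single (C.branch i) (n : ℤ) - Finsupp.single C.infty (n : ℤ)) := by
  classical
  intro P
  rw [Finsupp.sub_apply, Finsupp.single_apply, Finsupp.single_apply]
  rcases isAtInfinity_or_isOver P with h | ⟨a, h⟩
  · rw [C.isAtInfinity_iff_eq] at h
    subst h
    rw [if_neg (C.branch_ne_infty i), if_pos rfl, val_sub_infty]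
    simp
  · rw [if_neg h.ne_infty.symm]
    split_ifs with hi
    · subst hi
      rw [h.unique (C.isOver_branch i)] at h
      rw [h.val_sub_of_branch]
      simp
    · rw [h.val_sub_eq_one]
      · simp
      · rintro rfl
        exact hi h.eq_branch.symm

theorem IsOver.hasDiv_sub {P : C.Pt} {a : K} (h : C.IsOver P a) (ha : C.rhs.eval a ≠ 0) :
    HasDiv (C.x - algebraMap K C.FunctionField a)
      (∑ k ∈ Finset.range n, Finsupp.single (P.image (C.zetaAut ^ k)) (1 : ℤ)
        - Finsupp.single C.infty (n : ℤ)) := by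
  classical
  intro Q
  rw [Finsupp.sub_apply, Finsupp.finsetSum_apply]
  simp only [Finsupp.single_apply]
  rcases isAtInfinity_or_isOver Q with hQ | ⟨b, hQ⟩
  · rw [C.isAtInfinity_iff_eq] at hQ
    subst hQ
    rw [if_pos rfl, val_sub_infty, Finset.sum_eq_zero]
    · simp
    · intro k _
      rw [if_neg ((isOver_image k).2 h).ne_infty]
  · rw [if_neg hQ.ne_infty.symm, sub_zero]
    by_cases hab : b = a
    · subst hab
      obtain ⟨k, hk, rfl⟩ := h.exists_image_eq ha hQ
      rw [hQ.val_sub_of_eval_ne_zero ha, Finset.sum_eq_single k]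
      · simp
      · intro l hl hlk
        rw [if_neg]
        exact fun h' => hlk (h.image_injOn ha (Finset.mem_range.1 hl) hk h')
      · intro hk'
        exact absurd (Finset.mem_range.2 hk) hk'
    · rw [hQ.val_sub_eq_one hab, Finset.sum_eq_zero]
      · simp
      · intro k _
        rw [if_neg]
        rintro rfl
        exact hab (hQ.unique ((isOver_image k).2 h))

theorem hasDiv_y : HasDiv C.y
    (∑ i, Finsupp.single (C.branch i) (1 : ℤ) - Finsupp.single C.infty (d : ℤ)) := by
  classical
  intro P
  rw [Finsupp.sub_apply, Finsupp.finsetSum_apply]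
  simp only [Finsupp.single_apply]
  rcases point_cases P with rfl | ⟨i, rfl⟩ | ⟨a, ha, h⟩
  · rw [if_pos rfl, C.isAtInfinity_infty.val_y, Finset.sum_eq_zero]
    · simp
    · intro i _
      rw [if_neg (C.branch_ne_infty i)]
  · rw [if_neg (C.branch_ne_infty i).symm, (C.isOver_branch i).val_y_of_branch,
      Finset.sum_eq_single i]
    · simp
    · intro j _ hj
      rw [if_neg fun h => hj (C.branch_injective h)]
    · simp
  · rw [if_neg h.ne_infty.symm, h.val_y_of_eval_ne_zero ha, Finset.sum_eq_zero]
    · simp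
    · intro i _
      rw [if_neg (h.ne_branch ha i).symm]

theorem exists_hasDiv_sub (a : K) : ∃ D : Divisor K C.FunctionField, deg K C.FunctionField D = 0 ∧
    HasDiv (C.x - algebraMap K C.FunctionField a) D := by
  by_cases ha : C.rhs.eval a = 0
  · obtain ⟨i, rfl⟩ := eval_rhs_eq_zero_iff.1 ha
    exact ⟨_, by simp [deg_single], hasDiv_sub_branch i⟩
  · obtain ⟨P, hP⟩ := C.exists_point_isOver a
    exact ⟨_, by simp [deg_single], hP.hasDiv_sub ha⟩

theorem exists_hasDiv_ofPoly {p : K[X]} (hp : p ≠ 0) :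
    ∃ D : Divisor K C.FunctionField, deg K C.FunctionField D = 0 ∧ HasDiv (C.ofPoly p) D := by
  have h := (IsAlgClosed.splits p).eq_prod_roots
  have key : ∀ s : Multiset K, ∃ D : Divisor K C.FunctionField, deg K C.FunctionField D = 0 ∧
      HasDiv (C.ofPoly (s.map fun a => X - Polynomial.C a).prod) D := by
    intro s
    induction s using Multiset.induction_on with
    | empty => exact ⟨0, map_zero _, by simpa using hasDiv_one⟩
    | cons a s ih =>
      obtain ⟨D, hD, hDs⟩ := ih
      obtain ⟨E, hE, hEa⟩ := exists_hasDiv_sub (C := C) a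
      refine ⟨E + D, by rw [map_add, hD, hE, add_zero], ?_⟩
      rw [Multiset.map_cons, Multiset.prod_cons, map_mul, map_sub, ofPoly_X, ofPoly_C]
      exact hEa.mul hDs
  obtain ⟨D, hD, hDp⟩ := key p.roots
  refine ⟨0 + D, by rw [zero_add, hD], ?_⟩
  rw [h, map_mul, ofPoly_C]
  exact (hasDiv_algebraMap (leadingCoeff_ne_zero.2 hp)).mul hDp

theorem exists_hasDiv_ratFunc {h : RatFunc K} (hh : h ≠ 0) :
    ∃ D : Divisor K C.FunctionField, deg K C.FunctionField D = 0 ∧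
      HasDiv (algebraMap (RatFunc K) C.FunctionField h) D := by
  obtain ⟨D, hD, hDp⟩ := exists_hasDiv_ofPoly (C := C) (RatFunc.num_ne_zero hh)
  obtain ⟨E, hE, hEp⟩ := exists_hasDiv_ofPoly (C := C) h.denom_ne_zero
  refine ⟨D - E, by rw [map_sub, hD, hE, sub_zero], ?_⟩
  rw [ratFunc_eq_div]
  exact hDp.div hEp

/-- A pole of `f` is a pole of some term of its expansion, and nonzero terms have explicit divisors.
-/
theorem finite_one_lt_val (f : C.FunctionField) : {P : C.Pt | 1 < P.val f}.Finite := by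
  obtain ⟨h, rfl⟩ := C.exists_expansion f
  have h1 : ∀ j, {P : C.Pt | 1 < P.val (algebraMap (RatFunc K) C.FunctionField (h j) *
      C.y ^ j)}.Finite := by
    intro j
    rcases eq_or_ne (h j) 0 with h0 | h0
    · simp [h0]
    · obtain ⟨D, -, hD⟩ := exists_hasDiv_ratFunc (C := C) h0
      exact (hD.mul (hasDiv_y.pow j)).finite.subset fun P hP => hP.ne'
  refine ((Finset.range n).finite_toSet.biUnion fun j _ => h1 j).subset fun P hP => ?_
  by_contra hcon
  simp only [Set.mem_iUnion, not_exists] at hcon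
  have h2 : ∀ j ∈ Finset.range n, P.val (algebraMap (RatFunc K) C.FunctionField (h j) *
      C.y ^ j) ≤ 1 := fun j hj => not_lt.1 (hcon j hj)
  exact absurd (show 1 < P.val _ from hP) (not_lt.2 (Valuation.map_sum_le _ h2))

theorem exists_hasDiv {f : C.FunctionField} (hf : f ≠ 0) :
    ∃ D : Divisor K C.FunctionField, HasDiv f D := by
  refine exists_hasDiv_of_finite hf (((finite_one_lt_val f).union (finite_one_lt_val f⁻¹)).subset
    fun P hP => ?_)
  rcases lt_or_gt_of_ne hP with h | h
  · refine Or.inr ?_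
    change 1 < P.val f⁻¹
    rw [map_inv₀]
    exact (one_lt_inv₀ (zero_lt_iff.2 ((P.val.ne_zero_iff).2 hf))).2 h
  · exact Or.inl h

/-- The norm multiplies degrees by `n` and lands in `K(x)`, where divisors have degree zero by
factoring into the functions `x - a`. -/
theorem deg_eq_zero_of_hasDiv {f : C.FunctionField} (hf : f ≠ 0)
    {D : Divisor K C.FunctionField} (hD : HasDiv f D) : deg K C.FunctionField D = 0 := by
  obtain ⟨h, hh⟩ := exists_norm_eq f
  have hh0 : h ≠ 0 := by
    rintro rfl
    exact norm_ne_zero hf (by rw [hh, map_zero])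
  obtain ⟨E, hE, hEh⟩ := exists_hasDiv_ratFunc (C := C) hh0
  have h1 := hD.norm
  rw [hh] at h1
  rw [hEh.unique h1, map_sum] at hE
  simp only [deg_divMap, Finset.sum_const, Finset.card_range] at hE
  exact (smul_eq_zero.1 hE).resolve_left C.n_pos.ne'

end SpecialPoints

end SuperellipticCurve

namespace SuperellipticCurve

variable {K : Type*} [Field K] {n d : ℕ} {C : SuperellipticCurve K n d}

/-! ### Hilbert 90 -/

section Hilbert90

theorem norm_mul (f g : C.FunctionField) : C.norm (f * g) = C.norm f * C.norm g := by
  simp only [norm, map_mul, Finset.prod_mul_distrib]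

theorem norm_algebraMap (c : K) : C.norm (algebraMap K C.FunctionField c)
    = algebraMap K C.FunctionField (c ^ n) := by
  have : ∀ k, (C.zetaAut ^ k) (algebraMap K C.FunctionField c) = algebraMap K C.FunctionField c :=
    fun k => AlgEquiv.commutes _ _
  simp only [norm, this, Finset.prod_const, Finset.card_range, map_pow]

/-- Hilbert's theorem 90 for the cyclic extension of `K(x)` generated by `y`. -/
theorem exists_eq_mul_zetaAut_of_norm_eq_one {f : C.FunctionField} (hf : C.norm f = 1) :
    ∃ h, h ≠ 0 ∧ f * C.zetaAut h = h := by
  -- The cocycle attached to `f`; the norm condition says that it closes up, `c n = 1 = c 0`.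
  let c : ℕ → C.FunctionField := fun k => ∏ i ∈ Finset.range k, (C.zetaAut ^ i) f
  have hc0 : c 0 = 1 := Finset.prod_range_zero _
  have hcn : c n = 1 := hf
  have hsucc : ∀ k z, C.zetaAut ((C.zetaAut ^ k) z) = (C.zetaAut ^ (k + 1)) z := fun k z => by
    rw [pow_succ', AlgEquiv.mul_apply]
  have hc : ∀ k, f * C.zetaAut (c k) = c (k + 1) := by
    intro k
    simp only [c]
    rw [map_prod, Finset.prod_range_succ', mul_comm]
    simp only [hsucc, pow_zero, AlgEquiv.one_apply]
  -- The resolvent: every value of `r` solves the equation, so it remains to find a nonzero one.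
  let r : C.FunctionField → C.FunctionField := fun z =>
    ∑ k ∈ Finset.range n, c k * (C.zetaAut ^ k) z
  have hr : ∀ z, f * C.zetaAut (r z) = r z := by
    intro z
    have h1 := Finset.sum_range_succ' (fun k => c k * (C.zetaAut ^ k) z) n
    rw [Finset.sum_range_succ, hcn, hc0, C.zetaAut_pow_n, pow_zero] at h1
    have h2 := add_right_cancel h1
    simp only [r]
    rw [map_sum, Finset.mul_sum, h2]
    refine Finset.sum_congr rfl fun k _ => ?_
    rw [map_mul, ← mul_assoc, hc, hsucc]
  by_contra! hcon
  have hz : ∀ z, r z = 0 := fun z => by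
    by_contra h0
    exact hcon _ h0 (hr z)
  have h3 : ∀ j, ∑ k ∈ Finset.range n, c k * algebraMap K C.FunctionField ((C.ζ ^ k) ^ j) = 0 := by
    intro j
    have h4 := hz (C.y ^ j)
    have h5 : r (C.y ^ j) = (∑ k ∈ Finset.range n,
        c k * algebraMap K C.FunctionField ((C.ζ ^ k) ^ j)) * C.y ^ j := by
      rw [Finset.sum_mul]
      refine Finset.sum_congr rfl fun k _ => ?_
      rw [map_pow, zetaAut_pow_y, mul_pow, ← map_pow, mul_assoc]
    rw [h5] at h4
    exact (mul_eq_zero.1 h4).resolve_right (pow_ne_zero _ C.y_ne_zero)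
  -- Testing `r` on all powers of `y` replaces independence of characters: by orthogonality only `k
  -- = 0` survives, leaving `n ≠ 0`.
  have h6 : ∑ j ∈ Finset.range n,
      ∑ k ∈ Finset.range n, c k * algebraMap K C.FunctionField ((C.ζ ^ k) ^ j) = n := by
    rw [Finset.sum_comm]
    simp_rw [← Finset.mul_sum, ← map_sum]
    rw [Finset.sum_eq_single 0]
    · simp [hc0]
    · intro k hk hk0
      have h7 : C.ζ ^ k ≠ 1 :=
        C.ζ_primitive.pow_ne_one_of_pos_of_lt hk0 (Finset.mem_range.1 hk)
      rw [geom_sum_eq h7, ← pow_mul, mul_comm k n, pow_mul, C.ζ_primitive.pow_eq_one]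
      simp
    · intro h
      exact absurd (Finset.mem_range.2 C.n_pos) h
  rw [Finset.sum_congr rfl fun j _ => h3 j, Finset.sum_const_zero] at h6
  exact C.natCast_ne_zero' h6.symm

end Hilbert90

/-! ### Orders of rational functions of `x`, and divisors supported on branch points and infinity -/

section Valuations

theorem IsOver.val_ofPoly {P : C.Pt} {a : K} (h : C.IsOver P a) {p : K[X]} (hp : p ≠ 0) :
    P.val (C.ofPoly p)
      = P.val (C.x - algebraMap K C.FunctionField a) ^ p.rootMultiplicity a := by
  obtain ⟨q, hq, hqa⟩ := exists_eq_pow_rootMultiplicity_mul_and_not_dvd p hp a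
  rw [dvd_iff_isRoot] at hqa
  have h1 : P.val (C.ofPoly q) = 1 := Point.val_eq_one_of_sub_lt hqa (h.val_ofPoly_sub_lt q)
  conv_lhs => rw [hq]
  rw [map_mul, map_mul, h1, mul_one, map_pow, map_pow, map_sub, ofPoly_X, ofPoly_C]

variable [IsAlgClosed K]

/-- Because of total ramification, the order of `h_j y ^ j` at a branch point is congruent to `j`
modulo `n`. -/
theorem IsOver.exists_val_ratFunc_of_branch {P : C.Pt} {i : Fin d} (h : C.IsOver P (-C.α i))
    {r : RatFunc K} (hr : r ≠ 0) :
    ∃ m : ℤ, P.val (algebraMap (RatFunc K) C.FunctionField r) = WithZero.exp (n * m) := by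
  refine ⟨r.denom.rootMultiplicity (-C.α i) - r.num.rootMultiplicity (-C.α i), ?_⟩
  rw [ratFunc_eq_div, map_div₀, h.val_ofPoly (RatFunc.num_ne_zero hr), h.val_ofPoly r.denom_ne_zero,
    h.val_sub_of_branch, ← WithZero.exp_nsmul, ← WithZero.exp_nsmul, ← WithZero.exp_sub]
  congr 1
  simp only [nsmul_eq_mul]
  ring

/-- A rational function without finite poles is a polynomial. -/
theorem exists_ofPoly_eq [CharZero K] {h : RatFunc K} (hh : ∀ P : C.Pt, ∀ a, C.IsOver P a →
    P.val (algebraMap (RatFunc K) C.FunctionField h) ≤ 1) :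
    ∃ p, algebraMap (RatFunc K) C.FunctionField h = C.ofPoly p := by
  have hden : h.denom.natDegree = 0 := by
    by_contra hd
    obtain ⟨a, ha⟩ := IsAlgClosed.exists_root h.denom (by
      rw [degree_eq_natDegree h.denom_ne_zero]
      exact_mod_cast hd)
    obtain ⟨P, hP⟩ := C.exists_point_isOver a
    have hnum : h.num.eval a ≠ 0 := by
      intro hn
      obtain ⟨u, v, huv⟩ := h.isCoprime_num_denom
      have := congrArg (eval a) huv
      simp [hn, ha.eq_zero] at this
    have h1 : P.val (C.ofPoly h.num) = 1 :=
      Point.val_eq_one_of_sub_lt hnum (hP.val_ofPoly_sub_lt _)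
    have h2 : P.val (C.ofPoly h.denom) < 1 := by
      have := hP.val_ofPoly_sub_lt h.denom
      rwa [ha.eq_zero, map_zero, sub_zero] at this
    have h3 := hh P a hP
    rw [ratFunc_eq_div, map_div₀, h1, one_div, inv_le_one₀ (zero_lt_iff.2
      ((Valuation.ne_zero_iff _).2 (C.ofPoly_ne_zero h.denom_ne_zero)))] at h3
    exact absurd h2 (not_lt.2 h3)
  have h4 : h.denom = 1 := eq_one_of_monic_natDegree_zero h.monic_denom hden
  exact ⟨h.num, by rw [ratFunc_eq_div, h4, map_one, div_one]⟩

end Valuations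

section BranchDivisors

variable (C) in
/-- The function `y ^ j * ∏ (x + α_i) ^ (q_i)`. -/
def monomialFun (j : ℤ) (q : Fin d → ℤ) : C.FunctionField :=
  C.y ^ j * ∏ i, (C.x - algebraMap K C.FunctionField (-C.α i)) ^ q i

theorem sub_algebraMap_ne_zero (a : K) : C.x - algebraMap K C.FunctionField a ≠ 0 := by
  rw [← ofPoly_X, ← ofPoly_C, ← map_sub]
  exact C.ofPoly_ne_zero (X_sub_C_ne_zero a)

theorem mk_eq_mk_iff {D E : DivisorZero K C.FunctionField} :
    (QuotientAddGroup.mk D : C.Jac) = QuotientAddGroup.mk E ↔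
      -(D : Divisor K C.FunctionField) + E ∈ principal K C.FunctionField := by
  rw [QuotientAddGroup.eq, AddSubgroup.mem_addSubgroupOf]
  rfl

theorem monomialFun_ne_zero (j : ℤ) (q : Fin d → ℤ) : C.monomialFun j q ≠ 0 :=
  mul_ne_zero (zpow_ne_zero _ C.y_ne_zero)
    (Finset.prod_ne_zero_iff.2 fun _ _ => zpow_ne_zero _ (sub_algebraMap_ne_zero _))

theorem mem_torsion_iff {D : DivisorZero K C.FunctionField} :
    (QuotientAddGroup.mk D : C.Jac) ∈ C.torsion ↔
      (D : Divisor K C.FunctionField) - divMap C.zetaAut D ∈ principal K C.FunctionField := by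
  rw [torsion, AddMonoidHom.mem_ker, AddMonoidHom.sub_apply, sub_eq_zero, eq_comm]
  change (QuotientAddGroup.mk (divZeroMap C.zetaAut D) : C.Jac) = QuotientAddGroup.mk D ↔ _
  rw [mk_eq_mk_iff, neg_add_eq_sub]
  rfl

variable [CharZero K]

variable (C) in
/-- The divisor `∑ c_i (P_i - ∞)`, where the `P_i` are the branch points. -/
def branchDiv (c : Fin d → ℤ) : Divisor K C.FunctionField :=
  ∑ i, Finsupp.single (C.branch i) (c i) - Finsupp.single C.infty (∑ i, c i)

theorem deg_branchDiv (c : Fin d → ℤ) : deg K C.FunctionField (C.branchDiv c) = 0 := by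
  simp [branchDiv, deg_single]

theorem branchDiv_branch (c : Fin d → ℤ) (i : Fin d) : C.branchDiv c (C.branch i) = c i := by
  classical
  rw [branchDiv, Finsupp.sub_apply, Finsupp.finsetSum_apply,
    Finsupp.single_eq_of_ne (C.branch_ne_infty i), sub_zero, Finset.sum_eq_single i]
  · simp
  · intro j _ hj
    exact Finsupp.single_eq_of_ne fun h => hj (C.branch_injective h).symm
  · simp

theorem branchDiv_infty (c : Fin d → ℤ) : C.branchDiv c C.infty = -∑ i, c i := by
  classical
  rw [branchDiv, Finsupp.sub_apply, Finsupp.finsetSum_apply, Finset.sum_eq_zero]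
  · simp
  · intro j _
    exact Finsupp.single_eq_of_ne (C.branch_ne_infty j).symm

theorem IsOver.branchDiv_eq_zero {P : C.Pt} {a : K} (h : C.IsOver P a) (ha : C.rhs.eval a ≠ 0)
    (c : Fin d → ℤ) : C.branchDiv c P = 0 := by
  classical
  rw [branchDiv, Finsupp.sub_apply, Finsupp.finsetSum_apply,
    Finsupp.single_eq_of_ne h.ne_infty, sub_zero]
  exact Finset.sum_eq_zero fun i _ => Finsupp.single_eq_of_ne (h.ne_branch ha i)

variable [IsAlgClosed K]

/-- The coefficient at infinity is forced by the degree, so it need not be computed. -/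
theorem eq_branchDiv {D : Divisor K C.FunctionField} (hD : deg K C.FunctionField D = 0)
    (h : ∀ P a, C.IsOver P a → C.rhs.eval a ≠ 0 → D P = 0) :
    D = C.branchDiv fun i => D (C.branch i) := by
  have h1 : D - C.branchDiv (fun i => D (C.branch i))
      = Finsupp.single C.infty (D C.infty - C.branchDiv (fun i => D (C.branch i)) C.infty) := by
    classical
    ext P
    rw [Finsupp.sub_apply]
    rcases point_cases P with rfl | ⟨i, rfl⟩ | ⟨a, ha, hP⟩
    · simp
    · rw [branchDiv_branch, Finsupp.single_eq_of_ne (C.branch_ne_infty i), sub_self]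
    · rw [h P a hP ha, hP.branchDiv_eq_zero ha, Finsupp.single_eq_of_ne hP.ne_infty, sub_self]
  have h2 := congrArg (deg K C.FunctionField) h1
  rw [map_sub, hD, deg_branchDiv, deg_single, sub_zero] at h2
  rw [← h2, Finsupp.single_zero] at h1
  exact sub_eq_zero.1 h1

theorem hasDiv_branchDiv {f : C.FunctionField} (hf : f ≠ 0) {c : Fin d → ℤ}
    (hc : ∀ i, (C.branch i).val f = WithZero.exp (-(c i)))
    (h : ∀ P a, C.IsOver P a → C.rhs.eval a ≠ 0 → P.val f = 1) : HasDiv f (C.branchDiv c) := by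
  obtain ⟨D, hD⟩ := exists_hasDiv hf
  have h1 := eq_branchDiv (deg_eq_zero_of_hasDiv hf hD) fun P a hP ha => by
    have := (hD P).symm.trans (h P a hP ha)
    rw [← WithZero.exp_zero, WithZero.exp_inj] at this
    omega
  have h2 : (fun i => D (C.branch i)) = c := by
    funext i
    have := (hD (C.branch i)).symm.trans (hc i)
    rw [WithZero.exp_inj] at this
    omega
  rwa [h1, h2] at hD

theorem branchDiv_image (c : Fin d → ℤ) (P : C.Pt) (k : ℕ) :
    C.branchDiv c (P.image (C.zetaAut ^ k)) = C.branchDiv c P := by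
  rcases point_cases P with rfl | ⟨i, rfl⟩ | ⟨a, ha, hP⟩
  · rw [C.isAtInfinity_infty.image]
  · rw [(C.isOver_branch i).image_eq_of_branch]
  · rw [hP.branchDiv_eq_zero ha, ((isOver_image k).2 hP).branchDiv_eq_zero ha]

theorem branchDiv_sub (b c : Fin d → ℤ) : C.branchDiv (b - c) = C.branchDiv b - C.branchDiv c := by
  ext P
  rw [Finsupp.sub_apply]
  rcases point_cases P with rfl | ⟨i, rfl⟩ | ⟨a, ha, hP⟩
  · simp only [branchDiv_infty, Pi.sub_apply, Finset.sum_sub_distrib]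
    ring
  · simp only [branchDiv_branch, Pi.sub_apply]
  · simp only [hP.branchDiv_eq_zero ha, sub_zero]

theorem val_sub_branch_zpow (i j : Fin d) (m : ℤ) :
    (C.branch i).val ((C.x - algebraMap K C.FunctionField (-C.α j)) ^ m)
      = if i = j then WithZero.exp (-(n * m)) else 1 := by
  rw [map_zpow₀]
  split_ifs with h
  · subst h
    rw [(C.isOver_branch i).val_sub_of_branch, ← WithZero.exp_zsmul, smul_eq_mul]
    congr 1
    ring
  · rw [(C.isOver_branch i).val_sub_eq_one, one_zpow]
    exact fun h' => h (C.α_injective (neg_injective h'))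

theorem hasDiv_monomialFun (j : ℤ) (q : Fin d → ℤ) :
    HasDiv (C.monomialFun j q) (C.branchDiv fun i => j + n * q i) := by
  refine hasDiv_branchDiv (monomialFun_ne_zero j q) (fun i => ?_) fun P a hP ha => ?_
  · rw [monomialFun, map_mul, map_prod, map_zpow₀, (C.isOver_branch i).val_y_of_branch,
      ← WithZero.exp_zsmul]
    simp_rw [val_sub_branch_zpow]
    rw [Finset.prod_ite_eq Finset.univ i, if_pos (Finset.mem_univ _), ← WithZero.exp_add]
    congr 1
    simp only [smul_eq_mul]
    ring
  · rw [monomialFun, map_mul, map_prod, map_zpow₀, hP.val_y_of_eval_ne_zero ha, one_zpow, one_mul]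
    refine Finset.prod_eq_one fun i _ => ?_
    rw [map_zpow₀, hP.val_sub_eq_one, one_zpow]
    rintro rfl
    exact ha (eval_rhs_eq_zero_iff.2 ⟨i, rfl⟩)

/-- If `f` has this invariant divisor, a nonzero term of its expansion has no worse poles, so it has
the same divisor because both degrees vanish. Its orders at the branch points are all congruent to
its exponent of `y`. The converse is realized by `monomialFun`. -/
theorem branchDiv_mem_principal_iff (c : Fin d → ℤ) :
    C.branchDiv c ∈ principal K C.FunctionField ↔ ∃ j : ℤ, ∀ i, (n : ℤ) ∣ c i - j := by
  constructor
  · rintro ⟨f, hf, hD⟩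
    replace hD : HasDiv f (C.branchDiv c) := hD
    obtain ⟨h, hh⟩ := C.exists_expansion f
    obtain ⟨j, hj, hj0⟩ : ∃ j < n, h j ≠ 0 := by
      by_contra! hcon
      exact hf (hh.trans (Finset.sum_eq_zero fun i hi => by
        rw [hcon i (Finset.mem_range.1 hi)]; simp))
    set g := algebraMap (RatFunc K) C.FunctionField (h j) * C.y ^ j with hg
    have hg0 : g ≠ 0 := mul_ne_zero ((_root_.map_ne_zero _).2 hj0) (pow_ne_zero _ C.y_ne_zero)
    have hle : ∀ P : C.Pt, P.val g ≤ WithZero.exp (-(C.branchDiv c P)) := by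
      intro P
      refine C.val_term_le P (fun k => ?_) hj
      rw [← hh, ← Point.val_image, hD, branchDiv_image]
    obtain ⟨W, hW⟩ := exists_hasDiv hg0
    have h0 : W - C.branchDiv c = 0 := by
      refine eq_zero_of_deg_eq_zero (fun P => ?_) ?_
      · have := hle P
        rw [hW, WithZero.exp_le_exp] at this
        rw [Finsupp.sub_apply]
        omega
      · rw [map_sub, deg_eq_zero_of_hasDiv hg0 hW, deg_branchDiv, sub_zero]
    rw [sub_eq_zero] at h0
    refine ⟨j, fun i => ?_⟩
    have h1 := hW (C.branch i)
    obtain ⟨m, hm⟩ := (C.isOver_branch i).exists_val_ratFunc_of_branch hj0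
    rw [h0, branchDiv_branch, hg, map_mul, hm, map_pow, (C.isOver_branch i).val_y_of_branch,
      ← WithZero.exp_nsmul, ← WithZero.exp_add, WithZero.exp_inj, nsmul_eq_mul] at h1
    exact ⟨-m, by linarith⟩
  · rintro ⟨j, hj⟩
    choose q hq using hj
    refine ⟨C.monomialFun j q, monomialFun_ne_zero j q, ?_⟩
    have h1 := hasDiv_monomialFun (C := C) j q
    have h2 : (fun i => j + n * q i) = c := by
      funext i
      have := hq i
      linarith
    rwa [h2] at h1

variable (C) in
/-- The class of `∑ c_i (P_i - ∞)` in the jacobian. -/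
def branchClass (c : Fin d → ℤ) : C.Jac :=
  QuotientAddGroup.mk ⟨C.branchDiv c, deg_branchDiv c⟩

theorem branchClass_eq_iff (b c : Fin d → ℤ) :
    C.branchClass b = C.branchClass c ↔ ∃ j : ℤ, ∀ i, (n : ℤ) ∣ c i - b i - j := by
  rw [branchClass, branchClass, mk_eq_mk_iff, neg_add_eq_sub, ← branchDiv_sub,
    branchDiv_mem_principal_iff]
  rfl

theorem branchClass_mem_torsion (c : Fin d → ℤ) : C.branchClass c ∈ C.torsion := by
  rw [branchClass, mem_torsion_iff]
  have h1 : divMap C.zetaAut (C.branchDiv c) = C.branchDiv c := by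
    ext P
    obtain ⟨Q, rfl⟩ := (Point.perm C.zetaAut).surjective P
    change divMap C.zetaAut (C.branchDiv c) (Q.image C.zetaAut) = C.branchDiv c (Q.image C.zetaAut)
    have := branchDiv_image c Q 1
    rw [pow_one] at this
    rw [divMap_apply_image, this]
  rw [h1, sub_self]
  exact zero_mem _

end BranchDivisors

end SuperellipticCurve

/-! ### Classes fixed by `ζ` are supported on branch points and infinity -/

namespace SuperellipticCurve

variable {K : Type*} [Field K] {n d : ℕ} {C : SuperellipticCurve K n d}

theorem image_zetaAut_pow_image (P : C.Pt) (k : ℕ) :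
    (P.image (C.zetaAut ^ k)).image C.zetaAut = P.image (C.zetaAut ^ (k + 1)) := by
  rw [Point.image_image]
  rfl

theorem image_zetaAut_pow_n (P : C.Pt) : P.image (C.zetaAut ^ n) = P := by
  rw [C.zetaAut_pow_n]
  rfl

theorem eq_image_pow_of_eq_image {D : Divisor K C.FunctionField}
    (hD : ∀ P : C.Pt, D (P.image C.zetaAut) = D P) (P : C.Pt) (k : ℕ) :
    D (P.image (C.zetaAut ^ k)) = D P := by
  induction k with
  | zero => rfl
  | succ k ih => rw [← image_zetaAut_pow_image, hD, ih]

/-- The sum over the cyclic group telescopes, which says that the norm of a function with divisor `D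
- ζD` has trivial divisor. -/
theorem sum_divMap_sub_eq_zero (D : Divisor K C.FunctionField) :
    ∑ k ∈ Finset.range n, divMap (C.zetaAut ^ k).symm (D - divMap C.zetaAut D) = 0 := by
  ext P
  rw [Finsupp.finsetSum_apply]
  simp_rw [divMap_symm_apply, Finsupp.sub_apply]
  have h1 := Finset.sum_range_succ'
    (fun k => divMap C.zetaAut D (P.image (C.zetaAut ^ k))) n
  rw [Finset.sum_range_succ, image_zetaAut_pow_n, pow_zero] at h1
  have h2 := add_right_cancel (h1.trans (congrArg _ (rfl : _ = divMap C.zetaAut D P)))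
  simp_rw [← image_zetaAut_pow_image, divMap_apply_image] at h2
  rw [Finset.sum_sub_distrib, ← h2, sub_self]
  rfl

variable [CharZero K] [IsAlgClosed K]

/-- Absence of finite poles makes the function a polynomial in `x`, and order zero at infinity makes
its degree zero. -/
theorem exists_algebraMap_eq_of_hasDiv_zero {h : RatFunc K}
    (hh : HasDiv (algebraMap (RatFunc K) C.FunctionField h)
      (0 : Divisor K C.FunctionField)) :
    ∃ c : K, c ≠ 0 ∧ algebraMap (RatFunc K) C.FunctionField h = algebraMap K C.FunctionField c := by
  have h1 : ∀ P : C.Pt, P.val (algebraMap (RatFunc K) C.FunctionField h) = 1 := fun P => by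
    rw [hh]
    simp
  obtain ⟨p, hp⟩ := exists_ofPoly_eq (C := C) fun P _ _ => (h1 P).le
  have hp0 : p ≠ 0 := by
    rintro rfl
    have := h1 C.infty
    rw [hp, map_zero, map_zero] at this
    exact zero_ne_one this
  have h2 := h1 C.infty
  rw [hp, C.isAtInfinity_infty.val_ofPoly hp0, C.isAtInfinity_infty.val_x, ← WithZero.exp_nsmul,
    ← WithZero.exp_zero, WithZero.exp_inj, nsmul_eq_mul, mul_eq_zero] at h2
  have h3 : p.natDegree = 0 := by
    have h4 : (n : ℤ) ≠ 0 := by exact_mod_cast C.n_pos.ne'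
    exact_mod_cast h2.resolve_right h4
  rw [eq_C_of_natDegree_eq_zero h3] at hp hp0
  exact ⟨_, by simpa using hp0, by rw [hp, ofPoly_C]⟩

/-- A class fixed by `ζ` contains a divisor fixed by `ζ`. -/
theorem exists_invariant_divisor {D : Divisor K C.FunctionField}
    (hD : D - divMap C.zetaAut D ∈ principal K C.FunctionField) :
    ∃ E : Divisor K C.FunctionField, -E + D ∈ principal K C.FunctionField ∧
      ∀ P : C.Pt, E (P.image C.zetaAut) = E P := by
  obtain ⟨f, hf, hfD⟩ := hD
  replace hfD : HasDiv f _ := hfD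
  obtain ⟨h, hh⟩ := exists_norm_eq f
  have h1 := hfD.norm
  rw [sum_divMap_sub_eq_zero, hh] at h1
  obtain ⟨c, hc, hhc⟩ := exists_algebraMap_eq_of_hasDiv_zero h1
  -- The norm of a constant `b` is `b ^ n`, so this factor normalizes the norm of `f` to `1`.
  obtain ⟨b, hb⟩ := IsAlgClosed.exists_pow_nat_eq c⁻¹ C.n_pos
  have hb0 : b ≠ 0 := by
    rintro rfl
    rw [zero_pow C.n_pos.ne'] at hb
    exact inv_ne_zero hc hb.symm
  have h2 : C.norm (algebraMap K C.FunctionField b * f) = 1 := by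
    rw [norm_mul, norm_algebraMap, hh, hhc, hb, ← map_mul, inv_mul_cancel₀ hc, map_one]
  obtain ⟨z, hz, hfz⟩ := exists_eq_mul_zetaAut_of_norm_eq_one h2
  obtain ⟨W, hW⟩ := exists_hasDiv hz
  have h3 := (((hasDiv_algebraMap hb0).mul hfD).mul (hW.aut C.zetaAut))
  rw [hfz] at h3
  have h4 := hW.unique h3
  -- By `h4`, `W - ζ⁻¹W = D - ζD`; adding `ζ⁻¹W`, the divisor of the pullback of `z`, makes `D`
  -- invariant.
  refine ⟨D + divMap C.zetaAut.symm W, ?_, fun P => ?_⟩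
  · rw [mem_principal_iff]
    refine ⟨(C.zetaAut z)⁻¹, inv_ne_zero ((_root_.map_ne_zero C.zetaAut).2 hz), ?_⟩
    have h5 := (hW.aut C.zetaAut).inv
    rwa [show -(D + divMap C.zetaAut.symm W) + D = -(divMap C.zetaAut.symm W) by abel]
  · have h5 := DFunLike.congr_fun h4 (P.image C.zetaAut)
    simp only [Finsupp.add_apply, Finsupp.sub_apply, divMap_apply_image, divMap_symm_apply,
      Finsupp.zero_apply] at h5 ⊢
    linarith

/-- A divisor fixed by `ζ` is equivalent to one supported away from the unbranched finite points. -/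
theorem exists_hasDiv_of_invariant {D : Divisor K C.FunctionField}
    (hD : ∀ P : C.Pt, D (P.image C.zetaAut) = D P) :
    ∃ (r : C.FunctionField) (R : Divisor K C.FunctionField), r ≠ 0 ∧ HasDiv r R ∧
      ∀ P a, C.IsOver P a → C.rhs.eval a ≠ 0 → R P = D P := by
  classical
  choose Q hQ using C.exists_point_isOver
  have hDQ : ∀ P a, C.IsOver P a → C.rhs.eval a ≠ 0 → D P = D (Q a) := by
    intro P a hP ha
    obtain ⟨k, -, rfl⟩ := (hQ a).exists_image_eq ha hP
    exact eq_image_pow_of_eq_image hD _ k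
  -- The `x`-coordinate, with default `0` at infinity. A spurious `0` in `S` does no harm, because
  -- the exponent used in `r` is the coefficient of `D` at the chosen point `Q a`.
  let co : C.Pt → K := fun P => if h : ∃ a, C.IsOver P a then h.choose else 0
  have hco : ∀ P a, C.IsOver P a → co P = a := by
    intro P a hP
    have h : ∃ a, C.IsOver P a := ⟨a, hP⟩
    simp only [co, dif_pos h]
    exact h.choose_spec.unique hP
  let S := (D.support.image co).filter fun a => C.rhs.eval a ≠ 0
  let r := ∏ a ∈ S, (C.x - algebraMap K C.FunctionField a) ^ (D (Q a))
  have hr : r ≠ 0 :=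
    Finset.prod_ne_zero_iff.2 fun a _ => zpow_ne_zero _ (sub_algebraMap_ne_zero a)
  obtain ⟨R, hR⟩ := exists_hasDiv hr
  refine ⟨r, R, hr, hR, fun P a hP ha => ?_⟩
  have h1 : P.val r = WithZero.exp (-(D P)) := by
    have h2 : ∀ b ∈ S, P.val ((C.x - algebraMap K C.FunctionField b) ^ (D (Q b)))
        = if a = b then WithZero.exp (-(D (Q b))) else 1 := by
      intro b _
      rw [map_zpow₀]
      split_ifs with hab
      · subst hab
        rw [hP.val_sub_of_eval_ne_zero ha, ← WithZero.exp_zsmul]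
        simp
      · rw [hP.val_sub_eq_one hab, one_zpow]
    simp only [r]
    rw [map_prod, Finset.prod_congr rfl h2, Finset.prod_ite_eq]
    split_ifs with haS
    · rw [hDQ P a hP ha]
    · have h3 : D (Q a) = 0 := by
        by_contra h0
        refine haS (Finset.mem_filter.2 ⟨Finset.mem_image.2 ⟨Q a, ?_, hco _ _ (hQ a)⟩, ha⟩)
        exact Finsupp.mem_support_iff.2 h0
      rw [hDQ P a hP ha, h3]
      simp
  have h4 := (hR P).symm.trans h1
  rw [WithZero.exp_inj] at h4
  omega

theorem exists_branchClass_eq {D : C.Jac} (hD : D ∈ C.torsion) :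
    ∃ c : Fin d → ℤ, C.branchClass c = D := by
  obtain ⟨D, rfl⟩ := QuotientAddGroup.mk_surjective D
  rw [mem_torsion_iff] at hD
  obtain ⟨E, ⟨f, hf, hfE⟩, hinv⟩ := exists_invariant_divisor hD
  replace hfE : HasDiv f _ := hfE
  obtain ⟨r, R, hr, hrR, hRE⟩ := exists_hasDiv_of_invariant hinv
  have hdeg : deg K C.FunctionField (E - R) = 0 := by
    have h1 := deg_eq_zero_of_hasDiv hf hfE
    have h2 : deg K C.FunctionField (D : Divisor K C.FunctionField) = 0 := D.2
    rw [map_add, map_neg, h2] at h1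
    rw [map_sub, deg_eq_zero_of_hasDiv hr hrR]
    omega
  have h3 := eq_branchDiv hdeg fun P a hP ha => by
    rw [Finsupp.sub_apply, hRE P a hP ha, sub_self]
  refine ⟨fun i => (E - R) (C.branch i), mk_eq_mk_iff.2 (mem_principal_iff.2 ⟨r * f, mul_ne_zero hr hf, ?_⟩)⟩
  have h4 := hrR.mul hfE
  change HasDiv (r * f) (-(C.branchDiv fun i => (E - R) (C.branch i))
    + (D : Divisor K C.FunctionField))
  rw [← h3]
  rwa [show -(E - R) + (D : Divisor K C.FunctionField) = R + (-E + D) by abel]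

/-! ### Parametrization of `J[1 - ζ]` by families of residues -/

section Parametrization

variable (C) in
/-- The class of `∑ a_i (P_i - ∞)` for residue classes `a_i` modulo `n`, represented by integers
in `[0, n)`. -/
def residueClass (a : Fin d → ZMod n) : C.Jac := C.branchClass fun i => (a i).val

/-- The diagonal shift comes from powers of `y`; integer multiples of `n` come from the `x + α_i`.
-/
theorem residueClass_eq_iff (a b : Fin d → ZMod n) :
    C.residueClass a = C.residueClass b ↔ ∃ j : ZMod n, b = fun i => a i + j := by
  have : NeZero n := ⟨C.n_pos.ne'⟩
  rw [residueClass, residueClass, branchClass_eq_iff]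
  have key : ∀ (j : ℤ) i, (n : ℤ) ∣ ((b i).val : ℤ) - (a i).val - j ↔ b i = a i + j := by
    intro j i
    rw [← ZMod.intCast_zmod_eq_zero_iff_dvd]
    rw [Int.cast_sub, Int.cast_sub, Int.cast_natCast, Int.cast_natCast, ZMod.natCast_zmod_val,
      ZMod.natCast_zmod_val, sub_sub, sub_eq_zero]
  simp_rw [key]
  constructor
  · rintro ⟨j, hj⟩
    exact ⟨j, funext hj⟩
  · rintro ⟨j, rfl⟩
    obtain ⟨m, rfl⟩ := ZMod.intCast_surjective j
    exact ⟨m, fun i => rfl⟩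

theorem exists_residueClass_eq {D : C.Jac} (hD : D ∈ C.torsion) :
    ∃ a : Fin d → ZMod n, C.residueClass a = D := by
  have : NeZero n := ⟨C.n_pos.ne'⟩
  obtain ⟨c, rfl⟩ := exists_branchClass_eq hD
  refine ⟨fun i => (c i : ZMod n), ?_⟩
  rw [residueClass, branchClass_eq_iff]
  refine ⟨0, fun i => ?_⟩
  rw [← ZMod.intCast_zmod_eq_zero_iff_dvd]
  simp

theorem residueClass_mem_torsion (a : Fin d → ZMod n) : C.residueClass a ∈ C.torsion :=
  branchClass_mem_torsion _

variable (C) in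
theorem finite_torsion : Finite C.torsion := by
  have : NeZero n := ⟨C.n_pos.ne'⟩
  refine Finite.of_surjective
    (fun a : Fin d → ZMod n => (⟨C.residueClass a, residueClass_mem_torsion a⟩ : C.torsion)) ?_
  rintro ⟨D, hD⟩
  obtain ⟨a, rfl⟩ := exists_residueClass_eq hD
  exact ⟨a, rfl⟩

/-- Every class in `J[1 - ζ]` is represented by exactly `n` families of residue classes. -/
theorem sum_residueClass (F : C.Jac → ℚ) [NeZero n] :
    ∑ a : Fin d → ZMod n, F (C.residueClass a) = n * ∑ᶠ D : C.torsion, F D := by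
  classical
  have := C.finite_torsion
  have := Fintype.ofFinite C.torsion
  rw [finsum_eq_sum_of_fintype, Finset.mul_sum]
  let Φ : (Fin d → ZMod n) → C.torsion := fun a => ⟨C.residueClass a, residueClass_mem_torsion a⟩
  rw [← Finset.sum_fiberwise_of_maps_to (s := Finset.univ) (t := Finset.univ) (g := Φ)
    (fun _ _ => Finset.mem_univ _)]
  refine Finset.sum_congr rfl fun D _ => ?_
  obtain ⟨a, ha⟩ := exists_residueClass_eq D.2
  have h1 : (Finset.univ.filter fun b => Φ b = D)
      = Finset.univ.image fun j : ZMod n => fun i => a i + j := by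
    ext b
    rw [Finset.mem_filter, Finset.mem_image]
    constructor
    · rintro ⟨-, hb⟩
      have h2 : C.residueClass a = C.residueClass b := by rw [ha, ← hb]
      obtain ⟨j, rfl⟩ := (residueClass_eq_iff a b).1 h2
      exact ⟨j, Finset.mem_univ _, rfl⟩
    · rintro ⟨j, -, rfl⟩
      refine ⟨Finset.mem_univ _, Subtype.ext ?_⟩
      rw [← ha]
      exact ((residueClass_eq_iff _ _).2 ⟨j, rfl⟩).symm
  have h2 : (Finset.univ.filter fun b => Φ b = D).card = n := by
    rw [h1, Finset.card_image_of_injective, Finset.card_univ, ZMod.card]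
    intro j k hjk
    exact add_left_cancel (congrFun hjk ⟨0, by have := C.two_le_d; omega⟩)
  rw [Finset.sum_congr rfl (g := fun _ => F D), Finset.sum_const, h2, nsmul_eq_mul]
  intro b hb
  rw [Finset.mem_filter] at hb
  rw [← hb.2]

end Parametrization

end SuperellipticCurve

/-- The sum of the representatives in `[0, n)` of a family of residue classes. -/
def residueSum {n d : ℕ} (a : Fin d → ZMod n) : ℕ := ∑ i, (a i).val

/-! ### Eigenspaces of Riemann-Roch spaces and the gaps at infinity -/

namespace SuperellipticCurve

variable {K : Type*} [Field K] {n d : ℕ} {C : SuperellipticCurve K n d}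

theorem ofPoly_linear (j : Fin d) : C.ofPoly (X - Polynomial.C (-C.α j))
    = C.x - algebraMap K C.FunctionField (-C.α j) := by
  rw [map_sub, ofPoly_X, ofPoly_C]

variable (C) in
/-- The eigenfunction `y ^ j * ∏ (x + α_i) ^ (-⌊(c_i + j) / n⌋)`. -/
def eigenFun (c : Fin d → ℤ) (j : ℕ) : C.FunctionField :=
  C.monomialFun j fun i => -((c i + j) / n)

/-- The `ζ ^ j`-eigenspace is a line over `K(x)`, so `eigenFun` generates it just as `y ^ j` does.
-/
theorem exists_term_eq_mul_eigenFun (c : Fin d → ℤ) (j : ℕ) (h : RatFunc K) :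
    ∃ r : RatFunc K, algebraMap (RatFunc K) C.FunctionField h * C.y ^ j
      = algebraMap (RatFunc K) C.FunctionField r * C.eigenFun c j := by
  refine ⟨h * ∏ i, (algebraMap K[X] (RatFunc K) (X - Polynomial.C (-C.α i))) ^ ((c i + j) / n), ?_⟩
  have h1 : ∀ i, algebraMap (RatFunc K) C.FunctionField
      (algebraMap K[X] (RatFunc K) (X - Polynomial.C (-C.α i)))
      = C.x - algebraMap K C.FunctionField (-C.α i) := ofPoly_linear
  rw [eigenFun, monomialFun, map_mul, map_prod, zpow_natCast]
  simp_rw [map_zpow₀, h1, zpow_neg]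
  rw [Finset.prod_inv_distrib]
  have h2 : ∏ i, (C.x - algebraMap K C.FunctionField (-C.α i)) ^ ((c i + j) / n) ≠ 0 :=
    Finset.prod_ne_zero_iff.2 fun _ _ => zpow_ne_zero _ (sub_algebraMap_ne_zero _)
  field_simp

variable [CharZero K]

variable (C) in
/-- The divisor `∑ c_i (P_i - ∞) + m ∞`. -/
def shiftDiv (c : Fin d → ℤ) (m : ℤ) : Divisor K C.FunctionField :=
  C.branchDiv c + Finsupp.single C.infty m

theorem shiftDiv_branch (c : Fin d → ℤ) (m : ℤ) (i : Fin d) :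
    C.shiftDiv c m (C.branch i) = c i := by
  rw [shiftDiv, Finsupp.add_apply, branchDiv_branch,
    Finsupp.single_eq_of_ne (C.branch_ne_infty i), add_zero]

theorem shiftDiv_infty (c : Fin d → ℤ) (m : ℤ) : C.shiftDiv c m C.infty = m - ∑ i, c i := by
  rw [shiftDiv, Finsupp.add_apply, branchDiv_infty, Finsupp.single_eq_same]
  ring

theorem IsOver.shiftDiv_eq_zero {P : C.Pt} {a : K} (h : C.IsOver P a) (ha : C.rhs.eval a ≠ 0)
    (c : Fin d → ℤ) (m : ℤ) : C.shiftDiv c m P = 0 := by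
  rw [shiftDiv, Finsupp.add_apply, h.branchDiv_eq_zero ha, Finsupp.single_eq_of_ne h.ne_infty,
    add_zero]

variable [IsAlgClosed K]

theorem shiftDiv_image (c : Fin d → ℤ) (m : ℤ) (P : C.Pt) (k : ℕ) :
    C.shiftDiv c m (P.image (C.zetaAut ^ k)) = C.shiftDiv c m P := by
  rcases point_cases P with rfl | ⟨i, rfl⟩ | ⟨a, ha, hP⟩
  · rw [C.isAtInfinity_infty.image]
  · rw [(C.isOver_branch i).image_eq_of_branch]
  · rw [hP.shiftDiv_eq_zero ha, ((isOver_image k).2 hP).shiftDiv_eq_zero ha]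

theorem mem_rrSpace_shiftDiv_iff (c : Fin d → ℤ) (m : ℤ) (f : C.FunctionField) :
    f ∈ rrSpace (C.shiftDiv c m) ↔ (∀ i, (C.branch i).val f ≤ WithZero.exp (c i)) ∧
      (∀ P a, C.IsOver P a → C.rhs.eval a ≠ 0 → P.val f ≤ 1) ∧
      C.infty.val f ≤ WithZero.exp (m - ∑ i, c i) := by
  constructor
  · intro h
    refine ⟨fun i => ?_, fun P a hP ha => ?_, ?_⟩
    · simpa only [shiftDiv_branch] using h (C.branch i)
    · simpa only [hP.shiftDiv_eq_zero ha, WithZero.exp_zero] using h P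
    · simpa only [shiftDiv_infty] using h C.infty
  · rintro ⟨h1, h2, h3⟩ P
    rcases point_cases P with rfl | ⟨i, rfl⟩ | ⟨a, ha, hP⟩
    · rw [shiftDiv_infty]; exact h3
    · rw [shiftDiv_branch]; exact h1 i
    · rw [hP.shiftDiv_eq_zero ha]; exact h2 P a hP ha

/-- The order here is the least integer that is at least `-c_i` and congruent to `j` modulo `n`,
that is, the least one allowed in this eigenspace. -/
theorem val_eigenFun_branch (c : Fin d → ℤ) (j : ℕ) (i : Fin d) :
    (C.branch i).val (C.eigenFun c j) = WithZero.exp (c i - (c i + j) % n) := by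
  rw [eigenFun, hasDiv_monomialFun, branchDiv_branch]
  congr 1
  have := Int.emod_add_mul_ediv (c i + j) n
  linarith

theorem IsOver.val_eigenFun {P : C.Pt} {a : K} (h : C.IsOver P a) (ha : C.rhs.eval a ≠ 0)
    (c : Fin d → ℤ) (j : ℕ) : P.val (C.eigenFun c j) = 1 := by
  rw [eigenFun, hasDiv_monomialFun, h.branchDiv_eq_zero ha]
  simp

theorem val_eigenFun_infty (c : Fin d → ℤ) (j : ℕ) :
    C.infty.val (C.eigenFun c j) = WithZero.exp (∑ i, (c i + j) % n - ∑ i, c i) := by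
  rw [eigenFun, hasDiv_monomialFun, branchDiv_infty, neg_neg, ← Finset.sum_sub_distrib]
  congr 1
  refine Finset.sum_congr rfl fun i _ => ?_
  have := Int.emod_add_mul_ediv (c i + j) n
  linarith

theorem val_ofPoly_mul_eigenFun_infty (c : Fin d → ℤ) (j : ℕ) {p : K[X]} (hp : p ≠ 0) :
    C.infty.val (C.ofPoly p * C.eigenFun c j)
      = WithZero.exp (n * p.natDegree + ∑ i, (c i + j) % n - ∑ i, c i) := by
  rw [map_mul, C.isAtInfinity_infty.val_ofPoly hp, C.isAtInfinity_infty.val_x, val_eigenFun_infty,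
    ← WithZero.exp_nsmul, ← WithZero.exp_add]
  congr 1
  simp only [nsmul_eq_mul]
  ring

theorem ofPoly_mul_eigenFun_mem (c : Fin d → ℤ) (j : ℕ) {p : K[X]} {m : ℤ}
    (hm : n * p.natDegree + ∑ i, (c i + j) % n ≤ m) :
    C.ofPoly p * C.eigenFun c j ∈ rrSpace (C.shiftDiv c m) := by
  have hn : (0 : ℤ) < n := by exact_mod_cast C.n_pos
  rcases eq_or_ne p 0 with rfl | hp
  · rw [map_zero, zero_mul]
    exact zero_mem _
  rw [mem_rrSpace_shiftDiv_iff]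
  refine ⟨fun i => ?_, fun P a hP ha => ?_, ?_⟩
  · rw [map_mul, val_eigenFun_branch]
    refine (mul_le_mul' (C.val_ofPoly_le_one (C.isOver_branch i).val_x_le_one p) le_rfl).trans ?_
    rw [one_mul, WithZero.exp_le_exp]
    have := Int.emod_nonneg (c i + j) hn.ne'
    omega
  · rw [map_mul, hP.val_eigenFun ha, mul_one]
    exact C.val_ofPoly_le_one hP.val_x_le_one p
  · rw [val_ofPoly_mul_eigenFun_infty c j hp, WithZero.exp_le_exp]
    linarith

/-- The eigenspace decomposition of the Riemann-Roch spaces of invariant divisors. -/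
theorem exists_eq_sum_mul_eigenFun {c : Fin d → ℤ} {m : ℤ} {f : C.FunctionField}
    (hf : f ∈ rrSpace (C.shiftDiv c m)) : ∃ p : ℕ → K[X],
      f = ∑ j ∈ Finset.range n, C.ofPoly (p j) * C.eigenFun c j ∧
      ∀ j < n, p j ≠ 0 → n * (p j).natDegree + ∑ i, (c i + j) % n ≤ m := by
  obtain ⟨h, hh⟩ := C.exists_expansion f
  have hn : (0 : ℤ) < n := by exact_mod_cast C.n_pos
  have key : ∀ j, ∃ p : K[X], j < n →
      algebraMap (RatFunc K) C.FunctionField (h j) * C.y ^ j = C.ofPoly p * C.eigenFun c j ∧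
      (p ≠ 0 → n * p.natDegree + ∑ i, (c i + j) % n ≤ m) := by
    intro j
    by_cases hj : j < n
    swap
    · exact ⟨0, fun hj' => absurd hj' hj⟩
    have hmem : algebraMap (RatFunc K) C.FunctionField (h j) * C.y ^ j
        ∈ rrSpace (C.shiftDiv c m) := fun P =>
      C.val_term_le P (fun k => by
        rw [← hh, ← Point.val_image, ← shiftDiv_image c m P k]
        exact hf _) hj
    obtain ⟨r, hr⟩ := exists_term_eq_mul_eigenFun (C := C) c j (h j)
    rw [hr, mem_rrSpace_shiftDiv_iff] at hmem
    obtain ⟨h1, h2, h3⟩ := hmem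
    have hr1 : ∀ P : C.Pt, ∀ a, C.IsOver P a →
        P.val (algebraMap (RatFunc K) C.FunctionField r) ≤ 1 := by
      intro P a hP
      rcases eq_or_ne r 0 with rfl | hr0
      · simp
      by_cases ha : C.rhs.eval a = 0
      · obtain ⟨i, rfl⟩ := eval_rhs_eq_zero_iff.1 ha
        obtain ⟨l, hl⟩ := hP.exists_val_ratFunc_of_branch hr0
        have h4 := h1 i
        rw [← hP.eq_branch, map_mul, hl, hP.eq_branch, val_eigenFun_branch, ← WithZero.exp_add,
          WithZero.exp_le_exp] at h4
        have h5 := Int.emod_lt_of_pos (c i + j) hn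
        rw [hl, ← WithZero.exp_zero, WithZero.exp_le_exp]
        -- A pole of `r` over a branch value would have order at least `n`, while the slack `(c_i +
        -- j) % n` is less than `n`.
        have h6 : l < 1 := by
          by_contra! hl1
          nlinarith
        nlinarith
      · have h4 := h2 P a hP ha
        rwa [map_mul, hP.val_eigenFun ha, mul_one] at h4
    obtain ⟨p, hp⟩ := exists_ofPoly_eq hr1
    refine ⟨p, fun _ => ⟨by rw [hr, hp], fun hp0 => ?_⟩⟩
    rw [hp, val_ofPoly_mul_eigenFun_infty c j hp0, WithZero.exp_le_exp] at h3
    linarith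
  choose p hp using key
  refine ⟨p, ?_, fun j hj => (hp j hj).2⟩
  rw [hh]
  exact Finset.sum_congr rfl fun j hj => (hp j (Finset.mem_range.1 hj)).1

/-- Since `h0` is a `finrank`, finiteness is what turns equality of `h0` into equality of nested
spaces. -/
theorem finiteDimensional_rrSpace_shiftDiv (c : Fin d → ℤ) (m : ℤ) :
    FiniteDimensional K (rrSpace (C.shiftDiv c m)) := by
  classical
  have hn : (0 : ℤ) < n := by exact_mod_cast C.n_pos
  let T : Finset C.FunctionField := (Finset.range n ×ˢ Finset.range (m.toNat + 1)).image
    fun q => C.ofPoly (X ^ q.2) * C.eigenFun c q.1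
  have hle : rrSpace (C.shiftDiv c m) ≤ Submodule.span K (T : Set C.FunctionField) := by
    intro f hf
    obtain ⟨p, rfl, hp⟩ := exists_eq_sum_mul_eigenFun hf
    refine Submodule.sum_mem _ fun j hj => ?_
    rw [Finset.mem_range] at hj
    rcases eq_or_ne (p j) 0 with h0 | h0
    · rw [h0, map_zero, zero_mul]
      exact zero_mem _
    have hdeg : (p j).natDegree < m.toNat + 1 := by
      have h1 := hp j hj h0
      have h2 : 0 ≤ ∑ i, (c i + j) % n := Finset.sum_nonneg fun i _ => Int.emod_nonneg _ hn.ne'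
      have h3 := Int.self_le_toNat m
      have h4 : ((p j).natDegree : ℤ) ≤ n * (p j).natDegree := by nlinarith
      omega
    rw [(p j).as_sum_range' _ hdeg, map_sum, Finset.sum_mul]
    refine Submodule.sum_mem _ fun t ht => ?_
    rw [← C_mul_X_pow_eq_monomial, map_mul, ofPoly_C, mul_assoc, ← Algebra.smul_def]
    refine Submodule.smul_mem _ _ (Submodule.subset_span ?_)
    exact Finset.mem_coe.2 (Finset.mem_image.2 ⟨(j, t), Finset.mem_product.2
      ⟨Finset.mem_range.2 hj, ht⟩, rfl⟩)
  have : FiniteDimensional K (Submodule.span K (T : Set C.FunctionField)) :=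
    FiniteDimensional.span_finset K T
  exact Submodule.finiteDimensional_of_le hle

/-- The space grows exactly when some `x ^ t` times an eigenfunction attains the allowed pole order
at infinity. -/
theorem rrSpace_shiftDiv_ne_iff (c : Fin d → ℤ) (m : ℤ) :
    rrSpace (C.shiftDiv c (m - 1)) ≠ rrSpace (C.shiftDiv c m) ↔
      ∃ j < n, ∃ t : ℕ, m = n * t + ∑ i, (c i + j) % n := by
  constructor
  · intro hne
    have hlt : ¬ rrSpace (C.shiftDiv c m) ≤ rrSpace (C.shiftDiv c (m - 1)) := by
      refine fun hle => hne (le_antisymm (fun f hf => ?_) hle)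
      rw [mem_rrSpace_shiftDiv_iff] at hf ⊢
      refine ⟨hf.1, hf.2.1, hf.2.2.trans ?_⟩
      rw [WithZero.exp_le_exp]
      linarith
    rw [SetLike.not_le_iff_exists] at hlt
    obtain ⟨f, hf, hf'⟩ := hlt
    obtain ⟨p, rfl, hp⟩ := exists_eq_sum_mul_eigenFun hf
    by_contra! hcon
    refine hf' (Submodule.sum_mem _ fun j hj => ?_)
    rw [Finset.mem_range] at hj
    rcases eq_or_ne (p j) 0 with h0 | h0
    · rw [h0, map_zero, zero_mul]
      exact zero_mem _
    refine ofPoly_mul_eigenFun_mem c j ?_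
    have h1 := hp j hj h0
    have h2 := hcon j hj (p j).natDegree
    omega
  · rintro ⟨j, hj, t, hm⟩ heq
    have h1 : C.ofPoly (X ^ t) * C.eigenFun c j ∈ rrSpace (C.shiftDiv c m) :=
      ofPoly_mul_eigenFun_mem c j (by rw [natDegree_X_pow]; exact hm.ge)
    rw [← heq, mem_rrSpace_shiftDiv_iff, val_ofPoly_mul_eigenFun_infty c j (by simp),
      natDegree_X_pow, WithZero.exp_le_exp] at h1
    linarith [h1.2.2]

theorem mem_gaps_branchClass_iff (c : Fin d → ℤ) (k : ℕ) :
    k ∈ gaps C.infty (C.branchClass c) ↔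
      ∀ j < n, ∀ t : ℕ, (k : ℤ) ≠ n * t + ∑ i, (c i + j) % n := by
  change h0 (C.shiftDiv c k) = h0 (C.shiftDiv c (k - 1)) ↔ _
  have h1 : rrSpace (C.shiftDiv c (k - 1)) ≤ rrSpace (C.shiftDiv c k) := by
    intro f hf
    rw [mem_rrSpace_shiftDiv_iff] at hf ⊢
    refine ⟨hf.1, hf.2.1, hf.2.2.trans ?_⟩
    rw [WithZero.exp_le_exp]
    linarith
  have h2 : h0 (C.shiftDiv c k) = h0 (C.shiftDiv c (k - 1)) ↔
      rrSpace (C.shiftDiv c (k - 1)) = rrSpace (C.shiftDiv c k) := by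
    have := finiteDimensional_rrSpace_shiftDiv (C := C) c k
    refine ⟨fun h => Submodule.eq_of_le_of_finrank_eq h1 h.symm, fun h => ?_⟩
    rw [h0, h0, h]
  rw [h2, ← not_iff_not, ← ne_eq, rrSpace_shiftDiv_ne_iff]
  push Not
  rfl

theorem mem_gaps_residueClass_iff (a : Fin d → ZMod n) (k : ℕ) :
    k ∈ gaps C.infty (C.residueClass a) ↔
      ∀ (j : ZMod n) (t : ℕ), k ≠ n * t + residueSum fun i => a i + j := by
  have : NeZero n := ⟨C.n_pos.ne'⟩
  rw [residueClass, mem_gaps_branchClass_iff]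
  have key : ∀ j : ZMod n, ∑ i, (((a i).val : ℤ) + (j.val : ℕ)) % n
      = (residueSum fun i => a i + j : ℕ) := by
    intro j
    simp only [residueSum, ZMod.val_add]
    push_cast
    rfl
  constructor
  · intro h j t hk
    refine h j.val j.val_lt t ?_
    rw [key, hk]
    push_cast
    rfl
  · intro h j hj t hk
    refine h (j : ZMod n) t ?_
    have h1 := key (j : ZMod n)
    rw [ZMod.val_natCast_of_lt hj] at h1
    rw [h1] at hk
    exact_mod_cast hk

end SuperellipticCurve

/-! ### Counting and summing gaps, and moments of residue sums -/

section Combinatorics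

theorem sum_nth_eq_sum (s : Finset ℕ) (f : ℕ → ℤ) :
    ∑ i ∈ Finset.range s.card, f (Nat.nth (· ∈ s) i) = ∑ k ∈ s, f k := by
  classical
  have hf : (Set.ofPred fun k => k ∈ s).Finite := s.finite_toSet
  have hs : hf.toFinset = s := by
    ext k
    rw [Set.Finite.mem_toFinset]
    rfl
  have hinj := Nat.nth_injOn hf
  have himg := Nat.image_nth_Iio_card hf
  rw [hs] at hinj himg
  have h1 : (Finset.range s.card).image (Nat.nth (· ∈ s)) = s := by
    rw [← Finset.coe_inj, Finset.coe_image, Finset.coe_range, himg]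
    rfl
  have h2 : Set.InjOn (Nat.nth (· ∈ s)) (Finset.range s.card) := by
    rw [Finset.coe_range]
    exact hinj
  conv_rhs => rw [← h1]
  rw [Finset.sum_image h2]

theorem sum_gapPartition (s : Finset ℕ) :
    (FunctionFieldCurve.gapPartition s.card (s : Set ℕ)).sum
      = ∑ k ∈ s, (k : ℤ) - ∑ i ∈ Finset.range s.card, (i : ℤ) := by
  have h1 : ∀ (f : ℕ → ℤ) (m : ℕ), ((List.range m).map f).sum = ∑ i ∈ Finset.range m, f i := by
    intro f m
    induction m with
    | zero => simp
    | succ m ih => rw [List.range_succ, Finset.sum_range_succ, ← ih]; simp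
  rw [FunctionFieldCurve.gapPartition, List.sum_reverse, h1, Finset.sum_sub_distrib,
    ← sum_nth_eq_sum s fun k => (k : ℤ)]
  rfl

theorem sum_range_cast (m : ℕ) : ∑ i ∈ Finset.range m, (i : ℚ) = m * (m - 1) / 2 := by
  induction m with
  | zero => simp
  | succ m ih => rw [Finset.sum_range_succ, ih]; push_cast; ring

theorem sum_range_cast_sq (m : ℕ) :
    ∑ i ∈ Finset.range m, (i : ℚ) ^ 2 = m * (m - 1) * (2 * m - 1) / 6 := by
  induction m with
  | zero => simp
  | succ m ih => rw [Finset.sum_range_succ, ih]; push_cast; ring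

variable {n d : ℕ}

theorem natCast_residueGaps (a : Fin d → ZMod n) (j : ZMod n) (q : ℕ) :
    (((residueSum fun i => a i + j) % n + n * q : ℕ) : ZMod n)
      = ((residueSum fun i => a i + j : ℕ) : ZMod n) := by
  simp

variable [NeZero n]

theorem ZMod.sum_val (f : ℕ → ℚ) : ∑ z : ZMod n, f z.val = ∑ i ∈ Finset.range n, f i := by
  refine Finset.sum_bij (fun z _ => z.val) (fun z _ => Finset.mem_range.2 z.val_lt)
    (fun z _ w _ h => ZMod.val_injective n h) (fun i hi => ?_) fun _ _ => rfl
  exact ⟨i, Finset.mem_univ _, ZMod.val_natCast_of_lt (Finset.mem_range.1 hi)⟩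

theorem natCast_residueSum (a : Fin d → ZMod n) (j : ZMod n) :
    ((residueSum fun i => a i + j : ℕ) : ZMod n) = ∑ i, a i + d * j := by
  simp [residueSum, Finset.sum_add_distrib]

/-- Modulo `n` the residue sum is affine in `j` with slope `d`, a unit. -/
theorem bijective_natCast_residueSum (h : Nat.Coprime n d) (a : Fin d → ZMod n) :
    Function.Bijective fun j : ZMod n => ((residueSum fun i => a i + j : ℕ) : ZMod n) := by
  rw [← Finite.injective_iff_bijective]
  intro j k hjk
  simp only [natCast_residueSum] at hjk
  have hu : IsUnit (d : ZMod n) := (ZMod.isUnit_iff_coprime d n).2 h.symm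
  exact hu.mul_left_cancel (add_left_cancel hjk)

/-- The natural numbers that are not of the form `n * t + s_j`, where `s_j` is the residue sum of
the family `a` shifted by `j`. -/
def residueGaps (a : Fin d → ZMod n) : Finset ℕ :=
  (Finset.univ.sigma fun j : ZMod n => Finset.range ((residueSum fun i => a i + j) / n)).image
    fun p => (residueSum fun i => a i + p.1) % n + n * p.2

/-- Exactly one `s_j` is congruent to `k`, and `k` is missed exactly when it lies below that `s_j`.
-/
theorem mem_residueGaps_iff (h : Nat.Coprime n d) (a : Fin d → ZMod n) (k : ℕ) :
    k ∈ residueGaps a ↔ ∀ (j : ZMod n) (t : ℕ), k ≠ n * t + residueSum fun i => a i + j := by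
  have hn := NeZero.pos n
  rw [residueGaps, Finset.mem_image]
  constructor
  · rintro ⟨⟨j, q⟩, hq, rfl⟩ j' t heq
    rw [Finset.mem_sigma, Finset.mem_range] at hq
    have h1 := congrArg (Nat.cast : ℕ → ZMod n) heq
    rw [natCast_residueGaps] at h1
    have h2 : j = j' := by
      apply (bijective_natCast_residueSum h a).1
      simpa using h1
    subst h2
    have h3 := Nat.mod_add_div (residueSum fun i => a i + j) n
    have h4 : n * q < n * ((residueSum fun i => a i + j) / n) := Nat.mul_lt_mul_of_pos_left hq.2 hn
    dsimp only at heq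
    omega
  · intro hk
    obtain ⟨j, hj⟩ := (bijective_natCast_residueSum h a).2 (k : ZMod n)
    dsimp only at hj
    rw [ZMod.natCast_eq_natCast_iff'] at hj
    have h1 := Nat.mod_add_div k n
    have h2 := Nat.mod_add_div (residueSum fun i => a i + j) n
    have h3 : k / n < (residueSum fun i => a i + j) / n := by
      by_contra! hle
      obtain ⟨t, ht⟩ := Nat.exists_eq_add_of_le hle
      refine hk j t ?_
      rw [ht, mul_add] at h1
      omega
    refine ⟨⟨j, k / n⟩, Finset.mem_sigma.2 ⟨Finset.mem_univ _, Finset.mem_range.2 h3⟩, ?_⟩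
    dsimp only
    rw [hj, h1]

theorem injective_residueGaps_param (h : Nat.Coprime n d) (a : Fin d → ZMod n) : Function.Injective
    fun p : (_ : ZMod n) × ℕ => (residueSum fun i => a i + p.1) % n + n * p.2 := by
  rintro ⟨j, q⟩ ⟨j', q'⟩ heq
  dsimp only at heq
  have h1 := congrArg (Nat.cast : ℕ → ZMod n) heq
  rw [natCast_residueGaps, natCast_residueGaps] at h1
  have h2 : j = j' := (bijective_natCast_residueSum h a).1 h1
  subst h2
  have h3 := Nat.eq_of_mul_eq_mul_left (NeZero.pos n) (Nat.add_left_cancel heq)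
  rw [h3]

theorem sum_residueGaps (h : Nat.Coprime n d) (a : Fin d → ZMod n) (f : ℕ → ℚ) :
    ∑ k ∈ residueGaps a, f k = ∑ j : ZMod n,
      ∑ q ∈ Finset.range ((residueSum fun i => a i + j) / n),
        f ((residueSum fun i => a i + j) % n + n * q) := by
  rw [residueGaps, Finset.sum_image (injective_residueGaps_param h a).injOn, Finset.sum_sigma]

theorem sum_residueSum_mod (h : Nat.Coprime n d) (a : Fin d → ZMod n) (f : ℕ → ℚ) :
    ∑ j : ZMod n, f ((residueSum fun i => a i + j) % n) = ∑ i ∈ Finset.range n, f i := by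
  rw [← ZMod.sum_val]
  refine Function.Bijective.sum_comp (bijective_natCast_residueSum h a)
    (fun z => f z.val) |>.symm.trans ?_ |>.symm
  simp only [ZMod.val_natCast]

theorem sum_residueSum_add (a : Fin d → ZMod n) :
    ∑ j : ZMod n, ((residueSum fun i => a i + j : ℕ) : ℚ) = d * (n * (n - 1) / 2) := by
  simp only [residueSum, Nat.cast_sum]
  rw [Finset.sum_comm]
  have h1 : ∀ i, ∑ j : ZMod n, ((a i + j).val : ℚ) = n * (n - 1) / 2 := by
    intro i
    rw [← sum_range_cast, ← ZMod.sum_val fun m => (m : ℚ)]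
    exact Equiv.sum_comp (Equiv.addLeft (a i)) fun z : ZMod n => (z.val : ℚ)
  simp only [h1, Finset.sum_const, Finset.card_univ, Fintype.card_fin, nsmul_eq_mul]

/-- There are `⌊s_j / n⌋` gaps in each class. The sum of these quotients is fixed because the `s_j`
have a constant total and their remainders permute `0, …, n - 1`. -/
theorem two_mul_card_residueGaps (h : Nat.Coprime n d) (a : Fin d → ZMod n) :
    (2 : ℚ) * (residueGaps a).card = (d - 1) * (n - 1) := by
  have hn : (n : ℚ) ≠ 0 := by exact_mod_cast NeZero.ne n
  have h1 := sum_residueGaps h a fun _ => 1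
  simp only [Finset.sum_const, nsmul_eq_mul, mul_one, Finset.card_range] at h1
  have h2 := sum_residueSum_mod h a fun m => (m : ℚ)
  have h3 := sum_residueSum_add a
  have h4 : ∑ j : ZMod n, ((residueSum fun i => a i + j : ℕ) : ℚ)
      = ∑ j : ZMod n, (((residueSum fun i => a i + j) % n : ℕ) : ℚ)
        + n * ∑ j : ZMod n, (((residueSum fun i => a i + j) / n : ℕ) : ℚ) := by
    rw [Finset.mul_sum, ← Finset.sum_add_distrib]
    refine Finset.sum_congr rfl fun j _ => ?_
    exact_mod_cast (Nat.mod_add_div (residueSum fun i => a i + j) n).symm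
  rw [h3, h2, ← h1, sum_range_cast] at h4
  apply mul_left_cancel₀ hn
  linarith

theorem two_mul_sum_residueGaps (h : Nat.Coprime n d) (a : Fin d → ZMod n) :
    (2 * n : ℚ) * ∑ k ∈ residueGaps a, (k : ℚ)
      = ∑ j : ZMod n, ((residueSum fun i => a i + j : ℕ) : ℚ) ^ 2
        - n * (n - 1) * (2 * n - 1) / 6 - n * ((d - 1) * (n * (n - 1) / 2)) := by
  have h1 := sum_residueGaps h a fun k => (k : ℚ)
  have h2 := sum_residueSum_mod h a fun m => (m : ℚ)
  have h3 := sum_residueSum_mod h a fun m => (m : ℚ) ^ 2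
  have h4 := sum_residueSum_add a
  rw [sum_range_cast] at h2
  rw [sum_range_cast_sq] at h3
  -- Sum of an arithmetic progression: with `s = r + nQ`, one has `2n ∑_{q < Q} (r + nq) = s² - r² -
  -- ns + nr`. After summing over `j`, only the `s²` terms depend on `a`.
  have h5 : ∀ j : ZMod n, (2 * n : ℚ) * ∑ q ∈ Finset.range ((residueSum fun i => a i + j) / n),
        (((residueSum fun i => a i + j) % n + n * q : ℕ) : ℚ)
      = ((residueSum fun i => a i + j : ℕ) : ℚ) ^ 2
        - (((residueSum fun i => a i + j) % n : ℕ) : ℚ) ^ 2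
        - n * ((residueSum fun i => a i + j : ℕ) : ℚ)
        + n * (((residueSum fun i => a i + j) % n : ℕ) : ℚ) := by
    intro j
    have h6 : ((residueSum fun i => a i + j : ℕ) : ℚ)
        = (((residueSum fun i => a i + j) % n : ℕ) : ℚ)
          + n * (((residueSum fun i => a i + j) / n : ℕ) : ℚ) := by
      exact_mod_cast (Nat.mod_add_div (residueSum fun i => a i + j) n).symm
    push_cast
    rw [Finset.sum_add_distrib, ← Finset.mul_sum, sum_range_cast, Finset.sum_const,
      Finset.card_range, nsmul_eq_mul, h6]
    ring
  rw [h1, Finset.mul_sum, Finset.sum_congr rfl fun j _ => h5 j, Finset.sum_add_distrib,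
    Finset.sum_sub_distrib, Finset.sum_sub_distrib, ← Finset.mul_sum, ← Finset.mul_sum, h2, h3, h4]
  ring

-- These are the moments of a sum of `d` independent uniform variables on `{0, …, n - 1}`, each of
-- mean `(n - 1) / 2` and variance `(n² - 1) / 12`; the induction splits off one variable.
variable (n) in
theorem sum_residueSum_and_sq (d : ℕ) :
    ∑ a : Fin d → ZMod n, (residueSum a : ℚ) = n ^ d * (d * (n - 1) / 2) ∧
    ∑ a : Fin d → ZMod n, (residueSum a : ℚ) ^ 2
      = n ^ d * (d * (n ^ 2 - 1) / 12 + d ^ 2 * (n - 1) ^ 2 / 4) := by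
  induction d with
  | zero => simp [residueSum]
  | succ d ih =>
    have h1 : ∀ f : ℕ → ℚ, ∑ a : Fin (d + 1) → ZMod n, f (residueSum a)
        = ∑ z : ZMod n, ∑ a : Fin d → ZMod n, f (z.val + residueSum a) := by
      intro f
      rw [← (Fin.consEquiv fun _ => ZMod n).sum_comp, Fintype.sum_prod_type]
      simp [residueSum, Fin.consEquiv, Fin.sum_univ_succ]
    have hz1 := ZMod.sum_val (n := n) fun m => (m : ℚ)
    have hz2 := ZMod.sum_val (n := n) fun m => (m : ℚ) ^ 2
    rw [sum_range_cast] at hz1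
    rw [sum_range_cast_sq] at hz2
    constructor
    · rw [h1 fun m => (m : ℚ)]
      push_cast
      simp only [Finset.sum_add_distrib, Finset.sum_const, nsmul_eq_mul, ih.1, ← Finset.mul_sum,
        hz1, Finset.card_univ, Fintype.card_pi, ZMod.card, Finset.prod_const, Fintype.card_fin]
      push_cast
      ring
    · rw [h1 fun m => (m : ℚ) ^ 2]
      push_cast
      simp only [add_sq, Finset.sum_add_distrib, Finset.sum_const, nsmul_eq_mul, ih.1, ih.2,
        ← Finset.mul_sum, ← Finset.sum_mul, mul_assoc, hz1, hz2, Finset.card_univ, Fintype.card_pi,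
        ZMod.card, Finset.prod_const, Fintype.card_fin]
      push_cast
      ring

theorem sum_sum_residueSum_sq :
    ∑ a : Fin d → ZMod n, ∑ j : ZMod n, ((residueSum fun i => a i + j : ℕ) : ℚ) ^ 2
      = n * (n ^ d * (d * (n ^ 2 - 1) / 12 + d ^ 2 * (n - 1) ^ 2 / 4)) := by
  rw [Finset.sum_comm]
  have h1 : ∀ j : ZMod n, ∑ a : Fin d → ZMod n, ((residueSum fun i => a i + j : ℕ) : ℚ) ^ 2
      = ∑ a : Fin d → ZMod n, (residueSum a : ℚ) ^ 2 := fun j =>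
    Equiv.sum_comp (Equiv.addRight fun _ : Fin d => j) fun a : Fin d → ZMod n => (residueSum a : ℚ) ^ 2
  simp only [h1, Finset.sum_const, Finset.card_univ, ZMod.card, nsmul_eq_mul,
    (sum_residueSum_and_sq n d).2]

end Combinatorics

/-! ### Assembling the formula -/

namespace SuperellipticCurve

variable {K : Type*} [Field K] {n d : ℕ} {C : SuperellipticCurve K n d}

theorem two_mul_genus (C : SuperellipticCurve K n d) : 2 * C.genus = (n - 1) * (d - 1) := by
  have h1 : 2 ∣ (n - 1) * (d - 1) := by
    have h2 := C.two_le_n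
    have h3 := C.two_le_d
    by_contra hcon
    rw [Nat.Prime.dvd_mul Nat.prime_two] at hcon
    push Not at hcon
    have h4 : 2 ∣ Nat.gcd n d := Nat.dvd_gcd (by omega) (by omega)
    rw [C.coprime] at h4
    omega
  exact Nat.mul_div_cancel' h1

theorem two_mul_genus_cast (C : SuperellipticCurve K n d) :
    (2 : ℚ) * C.genus = (n - 1) * (d - 1) := by
  have h1 := congrArg (Nat.cast : ℕ → ℚ) C.two_mul_genus
  have h2 := C.two_le_n
  have h3 := C.two_le_d
  rwa [Nat.cast_mul, Nat.cast_mul, Nat.cast_sub (by omega), Nat.cast_sub (by omega), Nat.cast_one,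
    Nat.cast_ofNat] at h1

variable [CharZero K] [IsAlgClosed K]

theorem gaps_residueClass [NeZero n] (a : Fin d → ZMod n) :
    gaps C.infty (C.residueClass a) = (residueGaps a : Set ℕ) := by
  ext k
  rw [mem_gaps_residueClass_iff, Finset.mem_coe, mem_residueGaps_iff C.coprime]

/-- The gap set has exactly `genus` elements, so `gapPartition` enumerates all of it and never
reaches the default value of `Nat.nth`. -/
theorem lamSize_residueClass [NeZero n] (a : Fin d → ZMod n) :
    (C.lamSize C.infty (C.residueClass a) : ℚ)
      = ∑ k ∈ residueGaps a, (k : ℚ) - C.genus * (C.genus - 1) / 2 := by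
  have h1 : (residueGaps a).card = C.genus := by
    have h2 := two_mul_card_residueGaps C.coprime a
    have h3 := C.two_mul_genus_cast
    have h4 : ((residueGaps a).card : ℚ) = C.genus := by linarith
    exact_mod_cast h4
  rw [lamSize, lam, gaps_residueClass, ← h1, sum_gapPartition, ← sum_range_cast]
  push_cast
  rfl

variable (C) in
theorem finsum_lamSize : ∑ᶠ D : C.torsion, (C.lamSize C.infty (D : C.Jac) : ℚ)
    = (C.genus : ℚ) * (n + 1) * n ^ (d - 1) / 12 := by
  have : NeZero n := ⟨C.n_pos.ne'⟩
  have hn : (n : ℚ) ≠ 0 := by exact_mod_cast NeZero.ne n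
  have h1 := sum_residueClass (C := C) fun D => (C.lamSize C.infty D : ℚ)
  have h2 := sum_sum_residueSum_sq (n := n) (d := d)
  have h3 : ∀ a : Fin d → ZMod n, (2 * n : ℚ) * (C.lamSize C.infty (C.residueClass a) : ℚ)
      = ∑ j : ZMod n, ((residueSum fun i => a i + j : ℕ) : ℚ) ^ 2
        - (n * (n - 1) * (2 * n - 1) / 6 + n * ((d - 1) * (n * (n - 1) / 2))
          + n * (C.genus * (C.genus - 1))) := by
    intro a
    rw [lamSize_residueClass, mul_sub, two_mul_sum_residueGaps C.coprime]
    ring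
  -- The factor `2n` clears the denominators of the gap sums; with the `n` families per class, the
  -- total acquires the factor `2n²` that is cancelled at the end.
  have h4 := congrArg ((2 * n : ℚ) * ·) h1
  simp only [Finset.mul_sum] at h4
  rw [Finset.sum_congr rfl fun a _ => h3 a, Finset.sum_sub_distrib, h2] at h4
  simp only [Finset.sum_const, nsmul_eq_mul, Finset.card_univ, Fintype.card_pi, ZMod.card,
    Finset.prod_const, Fintype.card_fin, Nat.cast_pow] at h4
  have hg : (C.genus : ℚ) = (n - 1) * (d - 1) / 2 := by linarith [C.two_mul_genus_cast]
  have hd : (n : ℚ) ^ d = n ^ (d - 1) * n := by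
    rw [← pow_succ]
    congr 1
    have := C.two_le_d
    omega
  rw [hg, hd] at h4
  rw [hg]
  have h5 : (2 * n * n : ℚ) ≠ 0 := by positivity
  apply mul_left_cancel₀ h5
  linear_combination -h4

end SuperellipticCurve

end

theorem mainTheorem7 (n d : ℕ) (C : SuperellipticCurve ℂ n d) :
    ∃ P : C.Pt, (∀ Q : C.Pt, C.IsAtInfinity Q ↔ Q = P) ∧
      Finite C.torsion ∧
      ∑ᶠ D : C.torsion, (C.lamSize P (D : C.Jac) : ℚ) =
        (C.genus : ℚ) * (n + 1) * n ^ (d - 1) / 12 :=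
  ⟨C.infty, fun _ => C.isAtInfinity_iff_eq, C.finite_torsion, C.finsum_lamSize⟩
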